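/- Let $\mathbb K$ be a field of characteristic $0$ and let $\mathfrak a=(A,d,\star,1)$ be a dg left-unital pre-Lie algebra over $\mathbb K$: $A$ is $\mathbb Z$-graded with differential $d$ of degree $-1$, which is a derivation of the degree $0$ bilinear product $\star$; one has $$(x\star y)\star z-x\star(y\star z)=(-1)^{|y||z|}\big((x\star z)\star y-x\star(z\star y)\big)$$ for homogeneous elements; and $1\in A_0$ satisfies $d(1)=0$ and $1\star x=x$ (it need not be a right unit). Suppose that $A$ has a complete weight grading: $A_p=\prod_{n\ge 0}A^{(n)}_p$ in each homological degree $p$, $1\in A^{(0)}$, $A^{(m)}\star A^{(n)}\subset A^{(m+n)}$, the product is compatible with the infinite sums of components, i.e. $\big(\prod_{i\ge m}A^{(i)}\big)\star\big(\prod_{j\ge n}A^{(j)}\big)\subset\prod_{k\ge m+n}A^{(k)}$ for all $m,n\ge 0$, and $g=\prod_{n\ge 1}A^{(n)}$ is stable under $d$. Let $g_0=\prod_{n\ge1}A^{(n)}_0$ be the degree $0$ part of $g$, with the Lie bracket $[x,y]=x\star y-y\star x$, and let $\mathrm{BCH}(x,y)=x+y+\frac12[x,y]+\cdots$ be the sum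 of the Baker--Campbell--Hausdorff series of $x,y\in g_0$. Let $\mathrm G=\{1+b : b\in g_0\}$ be the set of group-like elements. For $a\in A_0$ and $b\in g_0$ put $$a\circledcirc(1+b)=\sum_{n\ge0}\frac1{n!}\{a;\underbrace{b,\dots,b}_{n}\},$$ where the symmetric braces are defined by $\{a;\}=a$ and $$\{a;b_1,\dots,b_n\}=\{a;b_1,\dots,b_{n-1}\}\star b_n-\sum_{i=1}^{n-1}\{a;b_1,\dots,b_{i-1},b_i\star b_n,b_{i+1},\dots,b_{n-1}\}.$$ For $\lambda\in g_0$ put $e^\lambda=1+\sum_{n\ge1}\frac{1}{n!}\lambda^{\star n}$ with $\lambda^{\star n}=(\cdots((\lambda\star\lambda)\star\lambda)\cdots)\star\lambda$ ($n$ factors). (All series are finite sums in each weight.) Then $\Gamma=(g_0,\mathrm{BCH},0)$ and $\mathfrak G=(\mathrm G,\circledcirc,1)$ are groups, and the pre-Lie exponential map $\lambda\mapsto e^\lambda$ is a group isomorphism $\Gamma\to\mathfrak G$. -/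

import Mathlib

/-!
Conventions. A dg module is a family of modules `A p`, `p : ℤ`, and the weight grading presents
each `A p` as the full product `∏ n, A^(n)_p`. So the module of degree `p` is `∀ n, C p n`, where
`C p n` is the piece of homological degree `p` and weight `n`, and `x n` is the weight `n`
component of `x`. Products of elements of degrees `p` and `q` are written in degree `r` along a
proof of `p + q = r`, which avoids transports between equal degrees.
-/

/-- A dg left unital (right-symmetric) pre-Lie algebra `(A, d, ⋆, 1)` with homological convention
`|d| = -1`, together with a complete weight grading `A = ∏ n, A^(n)`. -/
structure WeightGradedDGPreLie (K : Type*) [Field K] (C : ℤ → ℕ → Type*)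
    [∀ p n, AddCommGroup (C p n)] [∀ p n, Module K (C p n)] where
  /-- the bilinear product `x ⋆ y`, homogeneous for the homological degree -/
  mul : ∀ {p q r : ℤ}, p + q = r → (∀ n, C p n) →ₗ[K] (∀ n, C q n) →ₗ[K] (∀ n, C r n)
  /-- the associator is right symmetric, with the Koszul sign -/
  right_symm : ∀ {p q r pq pr qr s : ℤ} (hpq : p + q = pq) (hpr : p + r = pr) (hqr : q + r = qr)
    (hs : p + q + r = s) (x : ∀ n, C p n) (y : ∀ n, C q n) (z : ∀ n, C r n),
    mul (show pq + r = s by omega) (mul hpq x y) z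
        - mul (show p + qr = s by omega) x (mul hqr y z)
      = (q * r).negOnePow •
        (mul (show pr + q = s by omega) (mul hpr x z) y
          - mul (show p + qr = s by omega) x (mul (show r + q = qr by omega) z y))
  /-- the differential, of degree `-1` -/
  d : ∀ {p q : ℤ}, q + 1 = p → (∀ n, C p n) →ₗ[K] (∀ n, C q n)
  d_d : ∀ {p q r : ℤ} (hp : q + 1 = p) (hq : r + 1 = q) (x : ∀ n, C p n), d hq (d hp x) = 0
  /-- the Leibniz rule `d (x ⋆ y) = d x ⋆ y + (-1)^|x| x ⋆ d y` -/
  leibniz : ∀ {p q r p' q' r' : ℤ} (h : p + q = r) (hp : p' + 1 = p) (hq : q' + 1 = q)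
    (hr : r' + 1 = r) (x : ∀ n, C p n) (y : ∀ n, C q n),
    d hr (mul h x y) = mul (show p' + q = r' by omega) (d hp x) y
      + p.negOnePow • mul (show p + q' = r' by omega) x (d hq y)
  /-- the unit, which lies in degree `0` and weight `0` -/
  unit : C 0 0
  /-- the unit is a unit on the left: `1 ⋆ x = x` -/
  unit_mul : ∀ {p : ℤ} (x : ∀ n, C p n), mul (zero_add p) (Pi.single 0 unit) x = x
  /-- the unit is a cycle -/
  d_unit : ∀ {q : ℤ} (hq : q + 1 = 0), d hq (Pi.single 0 unit) = 0
  /-- `A^(m) ⋆ A^(n) ⊆ A^(m+n)` -/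
  mul_weight : ∀ {p q r : ℤ} (h : p + q = r) (m n : ℕ) (a : C p m) (b : C q n) (k : ℕ),
    k ≠ m + n → mul h (Pi.single m a) (Pi.single n b) k = 0
  /-- compatibility of the product with the infinite sums of components:
  `(∏ i ≥ m, A^(i)) ⋆ (∏ j ≥ n, A^(j)) ⊆ ∏ k ≥ m + n, A^(k)` -/
  mul_complete : ∀ {p q r : ℤ} (h : p + q = r) (m n : ℕ) (x : ∀ n, C p n) (y : ∀ n, C q n),
    (∀ i < m, x i = 0) → (∀ j < n, y j = 0) → ∀ k < m + n, mul h x y k = 0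
  /-- the part `g = ∏ n ≥ 1, A^(n)` is stable under the differential -/
  d_weight : ∀ {p q : ℤ} (h : q + 1 = p) (x : ∀ n, C p n), x 0 = 0 → d h x 0 = 0

section Generic

/-- Iterated right products: `rightPow a n` is `a^{⋆(n+1)} = (⋯((a ⋆ a) ⋆ a)⋯) ⋆ a`,
with `n + 1` factors. -/
def rightPow {L : Type*} [Mul L] (a : L) : ℕ → L
  | 0 => a
  | n + 1 => rightPow a n * a

/-- The symmetric braces `{a; b₁, …, bₙ}` of a pre-Lie algebra: `{a; } = a` and
`{a; b₁, …, bₙ₊₁} = {a; b₁, …, bₙ} ⋆ bₙ₊₁ - ∑ i, {a; b₁, …, bᵢ ⋆ bₙ₊₁, …, bₙ}`. -/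
def brace {L : Type*} [NonUnitalNonAssocRing L] (a : L) : (n : ℕ) → (Fin n → L) → L
  | 0, _ => a
  | n + 1, b =>
      brace a n (Fin.init b) * b (Fin.last n)
        - ∑ i : Fin n, brace a n (Function.update (Fin.init b) i (Fin.init b i * b (Fin.last n)))

/-- The right-nested bracket `[a₁, [a₂, […, [aₙ₋₁, aₙ]⋯]]]` of a word. -/
def nestedBracket {L : Type*} [LieRing L] : List L → L
  | [] => 0
  | [a] => a
  | a :: b :: l => ⁅a, nestedBracket (b :: l)⁆

/-- The sequences `(r₁, s₁), …, (rₙ, sₙ)` of pairs of natural numbers with `rᵢ + sᵢ > 0` for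
all `i` and with `∑ i, (rᵢ + sᵢ) = N`. -/
def dynkinIndices (n N : ℕ) : Finset (Fin n → ℕ × ℕ) :=
  (Fintype.piFinset fun _ => Finset.range (N + 1) ×ˢ Finset.range (N + 1)).filter
    fun f => (∀ i, 0 < (f i).1 + (f i).2) ∧ ∑ i, ((f i).1 + (f i).2) = N

/-- The word `x^{r₁} y^{s₁} ⋯ x^{rₙ} y^{sₙ}`. -/
def dynkinWord {L : Type*} (x y : L) {n : ℕ} (f : Fin n → ℕ × ℕ) : List L :=
  (List.ofFn fun i => List.replicate (f i).1 x ++ List.replicate (f i).2 y).flatten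

/-- The homogeneous component of total order `N` of the Baker-Campbell-Hausdorff series
`log (exp x exp y)`, in Dynkin's form:
`∑ n, (-1)^(n-1) / n * ∑ (rᵢ, sᵢ), [x^{r₁} y^{s₁} ⋯ x^{rₙ} y^{sₙ}] / (N * ∏ i, rᵢ! sᵢ!)`. -/
noncomputable def bchTerm (K : Type*) [Field K] {L : Type*} [LieRing L] [LieAlgebra K L]
    (x y : L) (N : ℕ) : L :=
  ∑ n ∈ Finset.Icc 1 N, ∑ f ∈ dynkinIndices n N,
    (((-1) ^ (n + 1) / n / (N * ∏ i, (((f i).1.factorial : K) * (f i).2.factorial)) : K)) •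
      nestedBracket (dynkinWord x y f)

end Generic

namespace WeightGradedDGPreLie

variable {K : Type*} [Field K] {C : ℤ → ℕ → Type*}
  [∀ p n, AddCommGroup (C p n)] [∀ p n, Module K (C p n)]

/-- The degree `0` part `A_0 = ∏ n, A^(n)_0`. -/
def Deg0 (_S : WeightGradedDGPreLie K C) : Type _ := ∀ n, C 0 n

variable (S : WeightGradedDGPreLie K C)

instance : AddCommGroup S.Deg0 := inferInstanceAs (AddCommGroup (∀ n, C 0 n))

instance : Module K S.Deg0 := inferInstanceAs (Module K (∀ n, C 0 n))

/-- The left unit `1`, concentrated in weight `0`. -/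
instance : One S.Deg0 := ⟨Pi.single 0 S.unit⟩

/-- `A_0` is an (ungraded) right pre-Lie ring for the product `⋆`; in particular it carries the
Lie bracket `⁅x, y⁆ = x ⋆ y - y ⋆ x`. -/
instance : RightPreLieRing S.Deg0 where
  mul x y := S.mul (zero_add 0) x y
  left_distrib x y z := (S.mul (zero_add 0) x).map_add y z
  right_distrib x y z := (S.mul (zero_add 0)).map_add₂ x y z
  zero_mul x := (S.mul (zero_add 0)).map_zero₂ x
  mul_zero x := (S.mul (zero_add 0) x).map_zero
  assoc_symm' x y z := by
    have h := S.right_symm (zero_add 0) (zero_add 0) (zero_add 0)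
      (show (0 : ℤ) + 0 + 0 = 0 by norm_num) x y z
    rw [show (0 : ℤ) * 0 = 0 from rfl, Int.negOnePow_zero, one_smul] at h
    exact h

instance : RightPreLieAlgebra K S.Deg0 where
  smul_assoc c x y := (S.mul (zero_add 0)).map_smul₂ c x y
  smul_comm c x y := ((S.mul (zero_add 0) x).map_smul c y).symm

/-- The elements of degree `0` whose components of weight `< m` vanish. -/
def filtration (m : ℕ) : Submodule K S.Deg0 where
  carrier := {x | ∀ i < m, x i = 0}
  zero_mem' := fun _ _ => rfl
  add_mem' := fun {x y} hx hy i hi => by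
    change x i + y i = 0
    rw [hx i hi, hy i hi, add_zero]
  smul_mem' := fun c x hx i hi => by
    change c • x i = 0
    rw [hx i hi, smul_zero]

/-- The Lie algebra `g_0 = ∏ n ≥ 1, A^(n)_0`, with the bracket `[x, y] = x ⋆ y - y ⋆ x`. -/
def g0 : LieSubalgebra K S.Deg0 where
  carrier := {x | x 0 = 0}
  zero_mem' := rfl
  add_mem' := fun {x y} hx hy => by
    change x 0 + y 0 = 0
    rw [show x 0 = 0 from hx, show y 0 = 0 from hy, add_zero]
  smul_mem' := fun c x hx => by
    change c • x 0 = 0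
    rw [show x 0 = 0 from hx, smul_zero]
  lie_mem' := fun {x y} hx hy => by
    have key : ∀ x y : S.Deg0, x 0 = 0 → y 0 = 0 → (x * y) 0 = 0 := fun x y hx hy =>
      S.mul_complete (zero_add 0) 1 1 x y
        (fun i hi => by obtain rfl : i = 0 := by omega
                        exact hx)
        (fun i hi => by obtain rfl : i = 0 := by omega
                        exact hy) 0 (by norm_num)
    change (x * y) 0 - (y * x) 0 = 0
    rw [key x y hx hy, key y x hy hx, sub_zero]

/-- The set `G` of group-like elements: the elements of degree `0` whose component of weight `0`
is `1`, that is `{1} × g_0`. -/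
def GroupLike : Type _ := {x : S.Deg0 // x 0 = S.unit}

/-- The sum `∑ n, f n` of a series in `A_0`, computed in each weight. It is only used for series
whose terms `f n` have all their components of weight `< n` equal to zero, so that the sum in each
weight is finite (see `series_apply` and the lemmas that follow each use). -/
noncomputable def series (f : ℕ → S.Deg0) : S.Deg0 := fun k => ∑ᶠ n, f n k

variable {S}

theorem mul_mem_filtration {m n : ℕ} {x y : S.Deg0} (hx : x ∈ S.filtration m)
    (hy : y ∈ S.filtration n) : x * y ∈ S.filtration (m + n) :=
  S.mul_complete (zero_add 0) m n x y hx hy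

theorem filtration_mono {m n : ℕ} (h : m ≤ n) {x : S.Deg0} (hx : x ∈ S.filtration n) :
    x ∈ S.filtration m := fun i hi => hx i (hi.trans_le h)

theorem mem_filtration_one {x : S.Deg0} : x ∈ S.filtration 1 ↔ x 0 = 0 :=
  ⟨fun h => h 0 one_pos, fun h i hi => by
    obtain rfl : i = 0 := by omega
    exact h⟩

theorem sum_apply {ι : Type*} (s : Finset ι) (f : ι → S.Deg0) (k : ℕ) :
    (∑ i ∈ s, f i) k = ∑ i ∈ s, f i k :=
  Finset.sum_apply k s f

/-- The component of weight `k` of a convergent series is the finite sum of the components of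
weight `k` of its terms. -/
theorem series_apply {f : ℕ → S.Deg0} (hf : ∀ n, f n ∈ S.filtration n) (k : ℕ) :
    S.series f k = (∑ n ∈ Finset.range (k + 1), f n) k := by
  rw [sum_apply]
  refine finsum_eq_sum_of_support_subset _ fun n hn => ?_
  by_contra h
  exact hn (hf n k (by simpa using h))

theorem series_apply_zero {f : ℕ → S.Deg0} (hf : ∀ n, f n ∈ S.filtration n) :
    S.series f 0 = f 0 0 := by
  rw [series_apply hf, Finset.sum_range_one]

theorem rightPow_mem {a : S.Deg0} (ha : a 0 = 0) (n : ℕ) :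
    rightPow a n ∈ S.filtration (n + 1) := by
  induction n with
  | zero => exact mem_filtration_one.2 ha
  | succ n ih => exact mul_mem_filtration ih (mem_filtration_one.2 ha)

theorem brace_mem (a : S.Deg0) : ∀ (n : ℕ) (b : Fin n → S.Deg0) (w : Fin n → ℕ),
    (∀ i, b i ∈ S.filtration (w i)) → brace a n b ∈ S.filtration (∑ i, w i)
  | 0, _, _, _ => fun i hi => absurd hi (by simp)
  | n + 1, b, w, h => by
      have hi : ∀ i, Fin.init b i ∈ S.filtration (Fin.init w i) := fun i => h i.castSucc
      rw [brace, Fin.sum_univ_castSucc]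
      refine Submodule.sub_mem _
        (mul_mem_filtration (brace_mem a n _ (Fin.init w) hi) (h (Fin.last n)))
        (Submodule.sum_mem _ fun i _ => ?_)
      have := brace_mem a n
        (Function.update (Fin.init b) i (Fin.init b i * b (Fin.last n)))
        (Function.update (Fin.init w) i (Fin.init w i + w (Fin.last n))) (fun j => by
          rcases eq_or_ne j i with rfl | hj
          · simpa using mul_mem_filtration (hi j) (h (Fin.last n))
          · simpa [hj] using hi j)
      rw [Finset.sum_update_of_mem (Finset.mem_univ i)] at this
      convert this using 2
      rw [← Finset.add_sum_erase _ _ (Finset.mem_univ i), Finset.sdiff_singleton_eq_erase]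
      change Fin.init w i + _ + _ = _
      exact add_right_comm _ _ _

theorem brace_const_mem (a : S.Deg0) {b : S.Deg0} (hb : b 0 = 0) (n : ℕ) :
    brace a n (fun _ => b) ∈ S.filtration n := by
  simpa using brace_mem a n (fun _ => b) (fun _ => 1) (fun _ => mem_filtration_one.2 hb)

theorem nestedBracket_mem : ∀ l : List S.g0,
    ((nestedBracket l : S.g0) : S.Deg0) ∈ S.filtration l.length
  | [] => Submodule.zero_mem _
  | [a] => mem_filtration_one.2 a.2
  | a :: b :: l => by
      have ih := nestedBracket_mem (b :: l)
      have ha : (a : S.Deg0) ∈ S.filtration 1 := mem_filtration_one.2 a.2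
      have h1 := mul_mem_filtration ha ih
      have h2 := mul_mem_filtration ih ha
      rw [add_comm] at h1
      exact Submodule.sub_mem _ h1 h2

theorem dynkinWord_length {L : Type*} (x y : L) {n : ℕ} (f : Fin n → ℕ × ℕ) :
    (dynkinWord x y f).length = ∑ i, ((f i).1 + (f i).2) := by
  simp [dynkinWord, List.length_flatten, List.map_ofFn, List.sum_ofFn, Function.comp_def]

theorem bchTerm_mem (x y : S.g0) (N : ℕ) :
    ((bchTerm K x y N : S.g0) : S.Deg0) ∈ S.filtration N := by
  have h : bchTerm K x y N ∈ (S.filtration N).comap S.g0.toSubmodule.subtype := by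
    refine Submodule.sum_mem _ fun n _ => Submodule.sum_mem _ fun f hf =>
      Submodule.smul_mem _ _ ?_
    have hN : (dynkinWord x y f).length = N := by
      rw [dynkinWord_length]
      exact (Finset.mem_filter.1 hf).2.2
    have := nestedBracket_mem (dynkinWord x y f)
    rw [hN] at this
    exact this
  exact h

variable (S)

/-- The pre-Lie exponential `e^x = 1 + x + x^{⋆2}/2! + x^{⋆3}/3! + ⋯` of `x ∈ g_0`. -/
noncomputable def exp (x : S.g0) : S.GroupLike :=
  ⟨1 + S.series fun n => ((n + 1).factorial : K)⁻¹ • rightPow (x : S.Deg0) n, by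
    have hx : (x : S.Deg0) 0 = 0 := x.2
    change S.unit + S.series _ 0 = S.unit
    rw [series_apply_zero fun n => Submodule.smul_mem _ _
      (filtration_mono n.le_succ (rightPow_mem hx n))]
    change S.unit + ((0 + 1).factorial : K)⁻¹ • (x : S.Deg0) 0 = S.unit
    rw [hx, smul_zero, add_zero]⟩

/-- The product `BCH(x, y)` of `g_0`: the sum of the Baker-Campbell-Hausdorff series. -/
noncomputable def bch (x y : S.g0) : S.g0 :=
  ⟨S.series fun N => (bchTerm K x y N : S.g0), by
    change S.series _ 0 = 0
    rw [series_apply_zero (bchTerm_mem x y)]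
    simp only [bchTerm]
    rfl⟩

theorem sub_one_apply_zero (u : S.GroupLike) : (u.1 - 1) 0 = 0 := by
  change u.1 0 - S.unit = 0
  rw [u.2, sub_self]

/-- The circle product `a ⊚ (1 + b) = ∑ n, (1/n!) {a; b, …, b}`, for `a ∈ A_0` and `b ∈ g_0`;
the second argument is the group-like element `u = 1 + b`. -/
noncomputable def circ (a : S.Deg0) (u : S.GroupLike) : S.Deg0 :=
  S.series fun n => (n.factorial : K)⁻¹ • brace a n (fun _ => u.1 - 1)

theorem circ_apply_zero (a : S.Deg0) (u : S.GroupLike) : S.circ a u 0 = a 0 := by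
  rw [circ, series_apply_zero fun n => Submodule.smul_mem _ _
    (brace_const_mem a (S.sub_one_apply_zero u) n)]
  simp [brace]

/-- The circle product of two group-like elements. -/
noncomputable def circG (u v : S.GroupLike) : S.GroupLike :=
  ⟨S.circ u.1 v, (S.circ_apply_zero u.1 v).trans u.2⟩

end WeightGradedDGPreLie

/-! For `x ∈ g_0` let `R_x` be the right multiplication `a ↦ a ⋆ x`. The circle product with `e^x`
is an operator exponential: `a ⊚ e^x = exp(R_x) a` (`circ_exp`), and `e^x = exp(R_x) 1` since `1 ⋆ x
= x`. The first identity is proved for formal series in `t`: by the Leibniz rule and the symmetry of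
the braces, `a ⊚ e^{xt}` solves the equation `t f' = f ⋆ xt` with initial value `a`. It is then
evaluated at `t = 1`.

The pre-Lie identity says that `x ↦ -R_x` is a Lie homomorphism. Modulo weight `m` its values are
nilpotent, so the Baker-Campbell-Hausdorff formula in an associative algebra applies to them;
inverting both sides gives `exp(R_{BCH(x,y)}) = exp(R_y) exp(R_x)` (`rightExp_bch`). Hence `e^x ⊚
e^y = e^{BCH(x,y)}`. Since `e^x - e^y` agrees with `x - y` to leading order in the weight, the
exponential is bijective. The axioms for `⊚` follow from composition of operators, and those for BCH
by transport along the exponential.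

Dynkin's form of BCH (`truncExp_bch`) is obtained by a differential equation. If `e^Z = e^X e^Y` and
a derivation `D` fixes `X` and `Y`, then `D Z` is `log(E)/(E - 1)` applied to `X + e^{ad X} Y`,
where `E = e^{ad X} e^{ad Y}`. Expanding into words gives `N` times Dynkin's term in each order `N`,
and `D = t d/dt` multiplies that order by `N`. -/

/-! ### Truncated exponential and logarithm series. -/

open Finset in
theorem sum_range_antidiagonal_eq_sum_sum {V : Type*} [AddCommMonoid V] (M : ℕ) (f : ℕ → ℕ → V)
    (h : ∀ j k, M ≤ j ∨ M ≤ k → f j k = 0) :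
    ∑ n ∈ range (2 * M), ∑ p ∈ antidiagonal n, f p.1 p.2 = ∑ j ∈ range M, ∑ k ∈ range M, f j k := by
  rw [← Finset.sum_product', Finset.sum_sigma']
  refine Finset.sum_bij_ne_zero (fun p _ _ => p.2) ?_ ?_ ?_ ?_
  · rintro ⟨n, j, k⟩ h1 h2
    simp only [mem_product, mem_range]
    constructor <;> by_contra hc <;> exact h2 (h _ _ (by simp at hc ⊢; omega))
  · rintro ⟨n, j, k⟩ h1 _ ⟨n', j', k'⟩ h1' _ he
    simp only [mem_sigma, HasAntidiagonal.mem_antidiagonal] at h1 h1'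
    simp only [Prod.mk.injEq] at he
    obtain ⟨rfl, rfl⟩ := he
    obtain ⟨-, rfl⟩ := h1
    obtain ⟨-, rfl⟩ := h1'
    rfl
  · rintro ⟨j, k⟩ h1 h2
    simp only [mem_product, mem_range] at h1
    exact ⟨⟨j + k, j, k⟩, by simp; omega, h2, rfl⟩
  · intros; rfl

/-- The exponential series, cut off after `M` terms. -/
noncomputable def truncExp (K : Type*) [Field K] {R : Type*} [Ring R] [Algebra K R] (M : ℕ)
    (a : R) : R :=
  ∑ k ∈ Finset.range M, (k.factorial : K)⁻¹ • a ^ k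

section TruncExp

variable (K : Type*) [Field K] {R : Type*} [Ring R] [Algebra K R]

theorem truncExp_of_le {a : R} {m M : ℕ} (ha : a ^ m = 0) (h : m ≤ M) :
    truncExp K M a = truncExp K m a := by
  refine (Finset.sum_subset (Finset.range_subset_range.2 h) fun k _ hk => ?_).symm
  rw [pow_eq_zero_of_le (by simpa using hk) ha, smul_zero]

theorem map_truncExp {R' F : Type*} [Ring R'] [Algebra K R'] [FunLike F R R'] [AlgHomClass F K R R']
    (f : F) (M : ℕ) (a : R) : f (truncExp K M a) = truncExp K M (f a) := by
  simp [truncExp]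

theorem truncExp_succ_eq_one_add (M : ℕ) (a : R) :
    truncExp K (M + 1) a
      = 1 + a * ∑ k ∈ Finset.range M, ((k + 1).factorial : K)⁻¹ • a ^ k := by
  rw [truncExp, Finset.sum_range_succ', Finset.mul_sum, add_comm]
  simp [pow_succ']

theorem isUnit_truncExp {a : R} {M : ℕ} (ha : IsNilpotent a) :
    IsUnit (truncExp K (M + 1) a) := by
  rw [truncExp_succ_eq_one_add]
  refine IsNilpotent.isUnit_one_add (Commute.isNilpotent_mul_right ?_ ha)
  exact Commute.sum_right _ _ _ fun k _ => ((Commute.refl a).pow_right k).smul_right _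

variable [CharZero K]

theorem truncExp_neg_mul_truncExp {a : R} {M : ℕ} (ha : a ^ M = 0) :
    truncExp K M (-a) * truncExp K M a = 1 := by
  -- Restricting scalars from `K` to `ℚ` makes `IsNilpotent.exp` available.
  let _ : Module ℚ R := Module.compHom R (algebraMap ℚ K)
  have key : ∀ b : R, b ^ M = 0 → truncExp K M b = IsNilpotent.exp b := fun b hb => by
    rw [IsNilpotent.exp_eq_sum hb, truncExp]
    refine Finset.sum_congr rfl fun k _ => ?_
    change _ = (algebraMap ℚ K (k.factorial : ℚ)⁻¹) • b ^ k
    simp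
  rw [key _ (by rw [neg_pow, ha, mul_zero]), key _ ha]
  exact IsNilpotent.exp_neg_mul_exp_self ⟨M, ha⟩

open Polynomial in
/-- The identity `log (exp u) / u = 1` for truncated series. -/
theorem X_pow_dvd_truncLog_mul_sub_one (M : ℕ) :
    (X : K[X]) ^ M ∣ (∑ n ∈ Finset.range M, C ((-1) ^ n / (n + 1) : K) *
        (X * ∑ k ∈ Finset.range M, C (((k + 1).factorial : K)⁻¹) * X ^ k) ^ n) *
      (∑ k ∈ Finset.range M, C (((k + 1).factorial : K)⁻¹) * X ^ k) - 1 := by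
  set φ : K[X] := ∑ k ∈ Finset.range M, C (((k + 1).factorial : K)⁻¹) * X ^ k with hφ
  set w : K[X] := X * φ with hw
  set L : K[X] := ∑ n ∈ Finset.range M, C ((-1) ^ n / (n + 1) : K) * w ^ n with hL
  -- `w` is the truncation of `e^X - 1`, so `w' = 1 + w` up to the top term.
  have hw' : derivative w = 1 + w - C ((M.factorial : K)⁻¹) * X ^ M := by
    have h1 : w = ∑ k ∈ Finset.range M, C (((k + 1).factorial : K)⁻¹) * X ^ (k + 1) := by
      rw [hw, hφ, Finset.mul_sum]
      exact Finset.sum_congr rfl fun k _ => by ring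
    have h2 : derivative w = ∑ k ∈ Finset.range M, C ((k.factorial : K)⁻¹) * X ^ k := by
      rw [h1, derivative_sum]
      refine Finset.sum_congr rfl fun k _ => ?_
      rw [derivative_C_mul_X_pow, Nat.add_sub_cancel]
      congr 2
      have := Nat.cast_ne_zero (R := K).2 k.factorial_ne_zero
      have := Nat.cast_add_one_ne_zero (R := K) k
      rw [Nat.factorial_succ]
      push_cast
      field_simp
    have h3 := Finset.sum_range_succ (fun k => C ((k.factorial : K)⁻¹) * (X : K[X]) ^ k) M
    rw [Finset.sum_range_succ', ← h1] at h3
    rw [h2, eq_sub_iff_add_eq, ← h3]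
    simp [add_comm]
  have hP : derivative (w * L) = derivative w * ∑ n ∈ Finset.range M, (-w) ^ n := by
    rw [hL, Finset.mul_sum, derivative_sum, Finset.mul_sum]
    refine Finset.sum_congr rfl fun n _ => ?_
    have : w * (C ((-1) ^ n / (n + 1) : K) * w ^ n) = C ((-1) ^ n / (n + 1) : K) * w ^ (n + 1) := by
      ring
    rw [this, derivative_C_mul, derivative_pow, Nat.add_sub_cancel, neg_pow w]
    have h0 := Nat.cast_add_one_ne_zero (R := K) n
    have : C ((-1) ^ n / (n + 1) : K) * C ((n + 1 : ℕ) : K) = (-1) ^ n := by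
      rw [← C_mul]
      push_cast
      rw [div_mul_cancel₀ _ h0]
      simp
    linear_combination (w ^ n * derivative w) * this
  -- `w * L` is a truncation of `log (1 + w)`. Modulo `X ^ M` its derivative is `(1 + w) ∑ (-w)^n =
  -- 1 - (-w)^M`, and `X` divides `w`.
  have hdvd : X ^ M ∣ derivative (w * L) - 1 := by
    have hg := mul_neg_geom_sum (-w) M
    have hwM : (X : K[X]) ^ M ∣ (-w) ^ M := pow_dvd_pow_of_dvd (dvd_neg.2 (dvd_mul_right _ _)) M
    have : derivative (w * L) - 1
        = -(-w) ^ M - X ^ M * (C ((M.factorial : K)⁻¹) * ∑ n ∈ Finset.range M, (-w) ^ n) := by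
      rw [hP, hw']
      linear_combination hg
    rw [this]
    exact dvd_sub (dvd_neg.2 hwM) (dvd_mul_right _ _)
  -- The coefficient of `X ^ d` in `(X φ L)'` is `d + 1` times that in `φ L`; characteristic `0`
  -- allows the division.
  rw [X_pow_dvd_iff] at hdvd ⊢
  intro d hd
  have h := hdvd d hd
  rw [coeff_sub, coeff_derivative, hw, mul_assoc, coeff_X_mul, mul_comm φ L] at h
  rw [coeff_sub]
  have h0 := Nat.cast_add_one_ne_zero (R := K) d
  rcases d with _ | d
  · simpa using h
  · rw [coeff_one, if_neg (by omega), sub_zero] at h ⊢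
    exact (mul_eq_zero.1 h).resolve_right h0

/-- Obtained by substituting `a` for `X` in the polynomial congruence. With `a = ad Z` it inverts
the operator `(e^{ad Z} - 1) / ad Z`. -/
theorem truncLog_mul_of_pow_eq_zero {a : R} {M : ℕ} (ha : a ^ M = 0) :
    (∑ n ∈ Finset.range M, ((-1) ^ n / (n + 1) : K) • (truncExp K M a - 1) ^ n) *
      (∑ k ∈ Finset.range M, ((k + 1).factorial : K)⁻¹ • a ^ k) = 1 := by
  obtain ⟨q, hq⟩ := X_pow_dvd_truncLog_mul_sub_one K M
  have h := congrArg (Polynomial.aeval a) hq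
  simp only [map_sub, map_mul, map_sum, map_pow, Polynomial.aeval_X, Polynomial.aeval_C, map_one,
    ha, zero_mul, sub_eq_zero] at h
  rw [← truncExp_of_le K ha M.le_succ, truncExp_succ_eq_one_add, add_sub_cancel_left]
  simpa only [Algebra.smul_def] using h

end TruncExp

/-! ### The adjoint action and the derivative of the exponential. -/

section Adjoint

open Finset LieAlgebra

attribute [local instance] LieRing.ofAssociativeRing

variable {K : Type*} [Field K] {R : Type*} [Ring R] [Algebra K R]

/-- Left multiplication by `Z` is the sum of the commuting operators `ad Z` and right multiplication
by `Z`; apply the binomial theorem. -/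
theorem pow_mul_eq_sum_ad_pow (Z u : R) (n : ℕ) :
    Z ^ n * u = ∑ p ∈ antidiagonal n, n.choose p.1 • ((ad K R Z ^ p.1) u * Z ^ p.2) := by
  have h : LinearMap.mulLeft K Z = ad K R Z + LinearMap.mulRight K Z := by
    ext v
    simp [Ring.lie_def]
  have hc : Commute (ad K R Z) (LinearMap.mulRight K Z) := by
    ext v
    simp [Ring.lie_def, sub_mul, mul_assoc]
  rw [← LinearMap.mulLeft_apply K, ← LinearMap.pow_mulLeft, h, hc.add_pow',
    LinearMap.sum_apply]
  refine sum_congr rfl fun p _ => ?_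
  rw [LinearMap.smul_apply, (hc.pow_pow _ _).eq]
  simp [LinearMap.pow_mulRight]

theorem derivation_pow_succ_eq_sum_ad_pow (D : R →ₗ[K] R)
    (hD : ∀ a b, D (a * b) = D a * b + a * D b) (Z : R) (n : ℕ) :
    D (Z ^ (n + 1))
      = ∑ p ∈ antidiagonal n, (n + 1).choose (p.1 + 1) • ((ad K R Z ^ p.1) (D Z) * Z ^ p.2) := by
  induction n with
  | zero => simp
  | succ n ih =>
    -- The extra term `p = (n + 1, 0)` has coefficient `(n + 1).choose (n + 2) = 0`. With it both
    -- sums run over the same set and Pascal's rule adds them.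
    have h : ∑ p ∈ antidiagonal (n + 1), (n + 1).choose (p.1 + 1) • ((ad K R Z ^ p.1) (D Z) * Z ^ p.2)
        = D (Z ^ (n + 1)) * Z := by
      rw [Nat.antidiagonal_succ', sum_cons, ih, sum_mul, sum_map]
      simp [pow_succ, mul_assoc]
    rw [pow_succ, hD, pow_mul_eq_sum_ad_pow (K := K), ← h, ← sum_add_distrib]
    refine sum_congr rfl fun p _ => ?_
    rw [← add_smul, Nat.choose_succ_succ' (n + 1) p.1, add_comm]

variable [CharZero K]

/-- This is `e^Z u e^{-Z} = e^{ad Z} u`: the binomial coefficients divided by `n!` turn the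
expansion of `Z ^ n * u` into a Cauchy product. -/
theorem truncExp_mul_eq_truncExp_ad_mul {Z : R} {M : ℕ} (hZ : Z ^ M = 0) (hA : ad K R Z ^ M = 0)
    (u : R) : truncExp K M Z * u = truncExp K M (ad K R Z) u * truncExp K M Z := by
  have h1 : truncExp K M Z * u = ∑ n ∈ range (2 * M), ∑ p ∈ antidiagonal n,
      ((p.1.factorial : K)⁻¹ • (ad K R Z ^ p.1) u) * ((p.2.factorial : K)⁻¹ • Z ^ p.2) := by
    rw [← truncExp_of_le K hZ (show M ≤ 2 * M by omega), truncExp, sum_mul]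
    refine sum_congr rfl fun n _ => ?_
    rw [smul_mul_assoc, pow_mul_eq_sum_ad_pow (K := K), smul_sum]
    refine sum_congr rfl fun p hp => ?_
    obtain rfl := HasAntidiagonal.mem_antidiagonal.1 hp
    rw [smul_mul_smul_comm, ← Nat.cast_smul_eq_nsmul K, smul_smul, Nat.cast_add_choose]
    congr 1
    have := Nat.cast_ne_zero (R := K).2 (p.1 + p.2).factorial_ne_zero
    field_simp
  rw [h1, sum_range_antidiagonal_eq_sum_sum M fun j k =>
    ((j.factorial : K)⁻¹ • (ad K R Z ^ j) u) * ((k.factorial : K)⁻¹ • Z ^ k)]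
  · rw [truncExp, truncExp, LinearMap.sum_apply, sum_mul_sum]
    rfl
  · rintro j k (h | h)
    · simp [pow_eq_zero_of_le h hA]
    · simp [pow_eq_zero_of_le h hZ]

/-- The same Cauchy product argument for `D (Z ^ (n + 1))`; the shifted binomial coefficient
produces the series of `(e^{ad Z} - 1) / ad Z`. -/
theorem derivation_truncExp (D : R →ₗ[K] R) (hD : ∀ a b, D (a * b) = D a * b + a * D b)
    {Z : R} {M : ℕ} (hZ : Z ^ M = 0) (hA : ad K R Z ^ M = 0) :
    D (truncExp K M Z)
      = (∑ k ∈ range M, ((k + 1).factorial : K)⁻¹ • ad K R Z ^ k) (D Z) * truncExp K M Z := by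
  have hD1 : D 1 = 0 := by simpa using hD 1 1
  have h1 : D (truncExp K M Z) = ∑ n ∈ range (2 * M), ∑ p ∈ antidiagonal n,
      (((p.1 + 1).factorial : K)⁻¹ • (ad K R Z ^ p.1) (D Z)) * ((p.2.factorial : K)⁻¹ • Z ^ p.2) := by
    rw [← truncExp_of_le K hZ (show M ≤ 2 * M + 1 by omega), truncExp, sum_range_succ', map_add,
      pow_zero, map_smul, hD1, smul_zero, add_zero, map_sum]
    refine sum_congr rfl fun n _ => ?_
    rw [map_smul, derivation_pow_succ_eq_sum_ad_pow D hD, smul_sum]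
    refine sum_congr rfl fun p hp => ?_
    obtain rfl := HasAntidiagonal.mem_antidiagonal.1 hp
    rw [smul_mul_smul_comm, ← Nat.cast_smul_eq_nsmul K, smul_smul,
      show p.1 + p.2 + 1 = (p.1 + 1) + p.2 by omega, Nat.cast_add_choose]
    congr 1
    have := Nat.cast_ne_zero (R := K).2 ((p.1 + 1) + p.2).factorial_ne_zero
    field_simp
  rw [h1, sum_range_antidiagonal_eq_sum_sum M fun j k =>
    (((j + 1).factorial : K)⁻¹ • (ad K R Z ^ j) (D Z)) * ((k.factorial : K)⁻¹ • Z ^ k)]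
  · rw [truncExp, LinearMap.sum_apply, sum_mul_sum]
    rfl
  · rintro j k (h | h)
    · simp [pow_eq_zero_of_le h hA]
    · simp [pow_eq_zero_of_le h hZ]

/-- The differential equation for `Z = log (exp X exp Y)` along the Euler derivation. -/
theorem derivation_eq_of_truncExp_eq_mul (D : R →ₗ[K] R)
    (hD : ∀ a b, D (a * b) = D a * b + a * D b) {X Y Z : R} {M : ℕ} (hDX : D X = X) (hDY : D Y = Y)
    (hX : X ^ M = 0) (hY : Y ^ M = 0) (hZ : Z ^ M = 0) (hAX : ad K R X ^ M = 0)
    (hAY : ad K R Y ^ M = 0) (hAZ : ad K R Z ^ M = 0)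
    (h : truncExp K M Z = truncExp K M X * truncExp K M Y) :
    D Z = ∑ n ∈ range M, ((-1) ^ n / (n + 1) : K) •
      ((truncExp K M (ad K R X) * truncExp K M (ad K R Y) - 1) ^ n)
        (X + truncExp K M (ad K R X) Y) := by
  have hu : IsUnit (truncExp K M Z) := by
    rw [← truncExp_of_le K hZ M.le_succ]
    exact isUnit_truncExp K ⟨M, hZ⟩
  -- `ad V` kills `D V = V`, so only the term `k = 0` survives.
  have hDexp : ∀ V : R, D V = V → V ^ M = 0 → ad K R V ^ M = 0 →
      D (truncExp K M V) = V * truncExp K M V := by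
    intro V hV hVM hAM
    rw [derivation_truncExp D hD hVM hAM, hV]
    congr 1
    rcases M with _ | M
    · rw [pow_zero] at hVM
      have := subsingleton_of_zero_eq_one hVM.symm
      exact Subsingleton.elim _ _
    · rw [sum_range_succ', LinearMap.add_apply, LinearMap.sum_apply, sum_eq_zero]
      · simp
      · intro k _
        rw [LinearMap.smul_apply, pow_succ, Module.End.mul_apply]
        simp
  have hAd : truncExp K M (ad K R Z) = truncExp K M (ad K R X) * truncExp K M (ad K R Y) := by
    ext u
    apply hu.mul_right_cancel
    rw [← truncExp_mul_eq_truncExp_ad_mul hZ hAZ, h, mul_assoc,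
      truncExp_mul_eq_truncExp_ad_mul hY hAY, ← mul_assoc, truncExp_mul_eq_truncExp_ad_mul hX hAX,
      mul_assoc]
    rfl
  -- Apply `D` to `e^Z = e^X e^Y`, move `Y` to the left of `e^X` by conjugation, and cancel `e^Z`.
  have hmain : (∑ k ∈ range M, ((k + 1).factorial : K)⁻¹ • ad K R Z ^ k) (D Z)
      = X + truncExp K M (ad K R X) Y := by
    apply hu.mul_right_cancel
    rw [← derivation_truncExp D hD hZ hAZ, h, hD, hDexp X hDX hX hAX, hDexp Y hDY hY hAY, add_mul,
      ← mul_assoc (truncExp K M X), truncExp_mul_eq_truncExp_ad_mul hX hAX]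
    simp only [mul_assoc]
  have hL := congrArg (fun T => T (D Z)) (truncLog_mul_of_pow_eq_zero K hAZ)
  simp only [Module.End.mul_apply, hmain, hAd, Module.End.one_apply, LinearMap.sum_apply,
    LinearMap.smul_apply] at hL
  exact hL.symm

end Adjoint

/-! ### Expansion into nested brackets of words. -/

section Dynkin

open Finset LieAlgebra

variable {K : Type*} [Field K] {L L' : Type*} [LieRing L] [LieAlgebra K L] [LieRing L']
  [LieAlgebra K L']

theorem LieHom.map_nestedBracket (f : L →ₗ⁅K⁆ L') : ∀ l : List L,
    f (nestedBracket l) = nestedBracket (l.map f)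
  | [] => f.map_zero
  | [_] => rfl
  | a :: b :: l => by
    have ih := f.map_nestedBracket (b :: l)
    rw [nestedBracket, f.map_lie, ih]
    rfl

theorem map_dynkinWord {α β : Type*} (g : α → β) (x y : α) {n : ℕ} (f : Fin n → ℕ × ℕ) :
    (dynkinWord x y f).map g = dynkinWord (g x) (g y) f := by
  simp [dynkinWord, List.map_flatten, List.map_ofFn, Function.comp_def]

theorem LieHom.map_bchTerm (f : L →ₗ⁅K⁆ L') (x y : L) (N : ℕ) :
    f (bchTerm K x y N) = bchTerm K (f x) (f y) N := by
  have h (z : L) : f z = (f : L →ₗ[K] L') z := rfl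
  simp only [bchTerm, h, map_sum, map_smul]
  simp only [← h, f.map_nestedBracket, map_dynkinWord]

theorem nestedBracket_cons {l : List L} (hl : l ≠ []) (x : L) :
    nestedBracket (x :: l) = ⁅x, nestedBracket l⁆ := by
  obtain ⟨a, l, rfl⟩ := List.exists_cons_of_ne_nil hl
  rfl

theorem nestedBracket_replicate_append {l : List L} (hl : l ≠ []) (x : L) (r : ℕ) :
    nestedBracket (List.replicate r x ++ l) = (ad K L x ^ r) (nestedBracket l) := by
  induction r with
  | zero => rfl
  | succ r ih =>
    rw [List.replicate_succ, List.cons_append, nestedBracket_cons (by simp [hl]), ih, pow_succ']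
    rfl

theorem nestedBracket_replicate_add_two (x : L) (r : ℕ) :
    nestedBracket (List.replicate (r + 2) x) = 0 := by
  induction r with
  | zero => exact lie_self x
  | succ r ih => rw [List.replicate_succ, nestedBracket_cons (by simp), ih, lie_zero]

theorem dynkinWord_cons {α : Type*} (x y : α) {n : ℕ} (p : ℕ × ℕ) (f : Fin n → ℕ × ℕ) :
    dynkinWord x y (Fin.cons p f : Fin (n + 1) → ℕ × ℕ)
      = List.replicate p.1 x ++ (List.replicate p.2 y ++ dynkinWord x y f) := by
  simp [dynkinWord, List.ofFn_succ]

theorem dynkinWord_ne_nil {α : Type*} (x y : α) {n : ℕ} (f : Fin (n + 1) → ℕ × ℕ)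
    (hf : 0 < (f 0).1 + (f 0).2) : dynkinWord x y f ≠ [] := by
  rw [← List.length_pos_iff, WeightGradedDGPreLie.dynkinWord_length, Fin.sum_univ_succ]
  omega

theorem eq_or_eq_of_mem_dynkinWord {α : Type*} {x y a : α} {n : ℕ} {f : Fin n → ℕ × ℕ}
    (ha : a ∈ dynkinWord x y f) : a = x ∨ a = y := by
  simp only [dynkinWord, List.mem_flatten, List.mem_ofFn] at ha
  obtain ⟨_, ⟨i, rfl⟩, h⟩ := ha
  rcases List.mem_append.1 h with h | h
  · exact Or.inl (List.eq_of_mem_replicate h)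
  · exact Or.inr (List.eq_of_mem_replicate h)

/-- The pairs `(r, s) ≠ (0, 0)` with `r, s < M`. -/
def dynkinPairs (M : ℕ) : Finset (ℕ × ℕ) :=
  (range M ×ˢ range M).filter fun p => 0 < p.1 + p.2

variable (K)

theorem truncExp_ad_mul_truncExp_ad_sub_one (x y : L) (M : ℕ) :
    truncExp K (M + 1) (ad K L x) * truncExp K (M + 1) (ad K L y) - 1
      = ∑ p ∈ dynkinPairs (M + 1), ((p.1.factorial : K) * p.2.factorial)⁻¹ •
          (ad K L x ^ p.1 * ad K L y ^ p.2) := by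
  rw [truncExp, truncExp, sum_mul_sum, ← sum_product', dynkinPairs, sub_eq_iff_eq_add,
    ← sum_filter_add_sum_filter_not _ (fun p : ℕ × ℕ => 0 < p.1 + p.2)]
  congr 1
  · refine sum_congr rfl fun p _ => ?_
    rw [smul_mul_smul_comm, mul_inv]
  · have : (range (M + 1) ×ˢ range (M + 1)).filter (fun p : ℕ × ℕ => ¬ 0 < p.1 + p.2)
        = {(0, 0)} := by
      ext ⟨r, s⟩
      simp
      omega
    rw [this, sum_singleton]
    simp

/-- Blocks `x^r y^s` with `s ≥ 2` have zero bracket, those with `s = 1` give `(ad x)^r y`, and for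
`s = 0` only `r = 1` contributes, giving `x`. The cutoff `M + 2` guarantees that the exponents `0`
and `1` occur. -/
theorem add_truncExp_ad_apply (x y : L) (M : ℕ) :
    x + truncExp K (M + 2) (ad K L x) y
      = ∑ p ∈ dynkinPairs (M + 2), ((p.1.factorial : K) * p.2.factorial)⁻¹ •
          nestedBracket (List.replicate p.1 x ++ List.replicate p.2 y) := by
  rw [dynkinPairs, sum_filter_of_ne, sum_product_right, sum_range_succ', sum_range_succ',
    sum_eq_zero (fun s _ => sum_eq_zero fun r _ => ?_), zero_add, add_comm]
  · congr 1
    · rw [truncExp, LinearMap.sum_apply]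
      refine sum_congr rfl fun r _ => ?_
      rw [nestedBracket_replicate_append (K := K) (by simp)]
      simp [nestedBracket]
    · rw [sum_range_succ', sum_range_succ', sum_eq_zero]
      · simp [nestedBracket]
      · intro r _
        simp [nestedBracket_replicate_add_two]
  · rw [nestedBracket_replicate_append (K := K) (by simp), nestedBracket_replicate_add_two, map_zero,
      smul_zero]
  · rintro ⟨r, s⟩ _ h
    by_contra hc
    obtain ⟨rfl, rfl⟩ : r = 0 ∧ s = 0 := by simpa using hc
    exact h (by simp [nestedBracket])

/-- The vector supplies the innermost block of the word, and each application of the operator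
prepends one nonempty block `x^r y^s`. -/
theorem pow_truncExp_apply_eq_sum_nestedBracket (x y : L) (M n : ℕ) :
    ((truncExp K (M + 2) (ad K L x) * truncExp K (M + 2) (ad K L y) - 1) ^ n)
        (x + truncExp K (M + 2) (ad K L x) y)
      = ∑ f ∈ Fintype.piFinset fun _ : Fin (n + 1) => dynkinPairs (M + 2),
          (∏ i, ((f i).1.factorial : K) * (f i).2.factorial)⁻¹ •
            nestedBracket (dynkinWord x y f) := by
  induction n with
  | zero =>
    rw [pow_zero, Module.End.one_apply, add_truncExp_ad_apply]
    refine sum_nbij' (fun p _ => p) (fun f => f 0) ?_ ?_ ?_ ?_ ?_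
    · intro p hp
      simpa using hp
    · intro f hf
      exact Fintype.mem_piFinset.1 hf 0
    · intro p _
      rfl
    · intro f _
      ext i : 1
      rw [Fin.fin_one_eq_zero i]
    · intro p _
      simp [dynkinWord]
  | succ n ih =>
    rw [pow_succ', Module.End.mul_apply, ih, truncExp_ad_mul_truncExp_ad_sub_one,
      LinearMap.sum_apply]
    simp only [map_sum]
    rw [← sum_product']
    refine sum_nbij' (fun q => (Fin.cons q.1 q.2 : Fin (n + 2) → ℕ × ℕ))
      (fun f => (f 0, Fin.tail f)) ?_ ?_ ?_ ?_ ?_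
    · rintro ⟨p, f⟩ h
      rw [mem_product] at h
      rw [Fintype.mem_piFinset]
      intro i
      refine Fin.cases h.1 (fun j => ?_) i
      exact Fintype.mem_piFinset.1 h.2 j
    · intro f hf
      rw [Fintype.mem_piFinset] at hf
      exact mem_product.2 ⟨hf 0, Fintype.mem_piFinset.2 fun j => hf _⟩
    · rintro ⟨p, f⟩ _
      rfl
    · intro f _
      exact Fin.cons_self_tail f
    · rintro ⟨p, f⟩ h
      have hf : dynkinWord x y f ≠ [] := dynkinWord_ne_nil x y f
        (mem_filter.1 (Fintype.mem_piFinset.1 (mem_product.1 h).2 0)).2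
      rw [dynkinWord_cons, nestedBracket_replicate_append (K := K) (by simp [hf]),
        nestedBracket_replicate_append (K := K) hf, Fin.prod_univ_succ (n := n + 1)]
      simp only [Fin.cons_zero, Fin.cons_succ, mul_inv, map_smul, LinearMap.smul_apply, smul_smul,
        Module.End.mul_apply]
      rw [mul_comm]

variable [CharZero K]

/-- The factor `N` cancels Dynkin's denominator. As `N < M`, the bounds on the exponents and on the
number of nonempty blocks lose no word of length `N`. -/
theorem smul_bchTerm (x y : L) {N M : ℕ} (h : N < M) :
    (N : K) • bchTerm K x y N = ∑ n ∈ range M, ((-1) ^ n / (n + 1) : K) •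
      ∑ f ∈ Fintype.piFinset fun _ : Fin (n + 1) => dynkinPairs M,
        if ∑ i, ((f i).1 + (f i).2) = N then
          (∏ i, ((f i).1.factorial : K) * (f i).2.factorial)⁻¹ • nestedBracket (dynkinWord x y f)
        else 0 := by
  have hle {n : ℕ} (f : Fin n → ℕ × ℕ) (i : Fin n) :
      (f i).1 + (f i).2 ≤ ∑ i, ((f i).1 + (f i).2) :=
    single_le_sum (f := fun i => (f i).1 + (f i).2) (fun _ _ => Nat.zero_le _) (mem_univ i)
  have h1 (n : ℕ) : (Fintype.piFinset fun _ : Fin n => dynkinPairs M).filter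
      (fun f => ∑ i, ((f i).1 + (f i).2) = N) = dynkinIndices n N := by
    ext f
    simp only [dynkinIndices, dynkinPairs, mem_filter, Fintype.mem_piFinset, mem_product, mem_range]
    constructor
    · rintro ⟨hf, hN⟩
      refine ⟨fun i => ?_, fun i => (hf i).2, hN⟩
      have := hle f i
      omega
    · rintro ⟨-, hf, hN⟩
      refine ⟨fun i => ⟨?_, hf i⟩, hN⟩
      have := hle f i
      omega
  have h2 (n : ℕ) (hn : N < n) : dynkinIndices n N = ∅ := by
    refine filter_eq_empty_iff.2 fun f _ hf => ?_
    have := Finset.sum_le_sum (s := univ) (f := fun _ : Fin n => 1) (fun i _ => hf.1 i)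
    simp only [hf.2, sum_const, card_univ, Fintype.card_fin, smul_eq_mul, mul_one] at this
    omega
  simp only [← sum_filter, h1]
  rw [← sum_subset (range_subset_range.2 h.le) fun n _ hn => by
    rw [h2 (n + 1) (by simp at hn; omega), sum_empty, smul_zero]]
  rw [bchTerm, smul_sum]
  symm
  refine sum_nbij' (fun n => n + 1) (fun n => n - 1) ?_ ?_ ?_ ?_ ?_
  · intro n hn
    simp at hn ⊢
    omega
  · intro n hn
    simp at hn ⊢
    omega
  · intro n _
    rfl
  · intro n hn
    simp at hn
    omega
  · intro n hn
    have hN : (N : K) ≠ 0 := Nat.cast_ne_zero.2 (by simp at hn; omega)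
    rw [smul_sum, smul_sum]
    refine sum_congr rfl fun f _ => ?_
    rw [smul_smul, smul_smul, pow_add, pow_add]
    congr 1
    push_cast
    field_simp

/-- Sort the words by length; those of length at least `m` contribute nothing. -/
theorem truncLog_apply_eq_sum_smul_bchTerm {x y : L} {m M : ℕ} (hM : m ≤ M + 2)
    (hm : ∀ l : List L, (∀ a ∈ l, a = x ∨ a = y) → m ≤ l.length → nestedBracket l = 0) :
    ∑ n ∈ range (M + 2), ((-1) ^ n / (n + 1) : K) •
        ((truncExp K (M + 2) (ad K L x) * truncExp K (M + 2) (ad K L y) - 1) ^ n)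
          (x + truncExp K (M + 2) (ad K L x) y)
      = ∑ N ∈ range m, (N : K) • bchTerm K x y N := by
  rw [sum_congr rfl fun N hN => smul_bchTerm K x y ((mem_range.1 hN).trans_le hM), sum_comm]
  refine sum_congr rfl fun n _ => ?_
  rw [pow_truncExp_apply_eq_sum_nestedBracket, ← smul_sum, sum_comm]
  congr 1
  refine sum_congr rfl fun f _ => ?_
  rw [sum_ite_eq]
  split_ifs with h
  · rfl
  · rw [hm _ (fun a ha => eq_or_eq_of_mem_dynkinWord ha), smul_zero]
    rw [WeightGradedDGPreLie.dynkinWord_length]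
    simpa using h

end Dynkin

/-! ### The Baker-Campbell-Hausdorff formula in a nilpotent filtered algebra. -/

section NilpotentBCH

open Finset LieAlgebra

attribute [local instance] LieRing.ofAssociativeRing

variable {K : Type*} [Field K] {R : Type*} [Ring R] [Algebra K R] {G : ℕ → Submodule K R} {m : ℕ}

theorem pow_succ_mem_of_mul_mem (hmul : ∀ i j, ∀ a ∈ G i, ∀ b ∈ G j, a * b ∈ G (i + j)) {a : R}
    (ha : a ∈ G 1) (n : ℕ) : a ^ (n + 1) ∈ G (n + 1) := by
  induction n with
  | zero => simpa using ha
  | succ n ih => exact pow_succ a (n + 1) ▸ hmul _ _ _ ih _ ha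

theorem nestedBracket_mem_of_mul_mem (hmul : ∀ i j, ∀ a ∈ G i, ∀ b ∈ G j, a * b ∈ G (i + j)) :
    ∀ l : List R, (∀ a ∈ l, a ∈ G 1) → nestedBracket l ∈ G l.length
  | [], _ => Submodule.zero_mem _
  | [a], h => h a (by simp)
  | a :: b :: l, h => by
    have ih := nestedBracket_mem_of_mul_mem hmul (b :: l) fun c hc => h c (List.mem_cons_of_mem _ hc)
    have ha := h a (by simp)
    rw [nestedBracket, Ring.lie_def]
    refine Submodule.sub_mem _ ?_ (hmul _ _ _ ih _ ha)
    have := hmul _ _ _ ha _ ih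
    rwa [add_comm] at this

/-- Every monomial in the difference contains `b` and at least one more factor from `G 1`. -/
theorem add_pow_sub_pow_mem (hmul : ∀ i j, ∀ a ∈ G i, ∀ b ∈ G j, a * b ∈ G (i + j))
    (hanti : Antitone G) {k : ℕ} (hk : 1 ≤ k) {a b : R} (ha : a ∈ G 1) (hb : b ∈ G k) (n : ℕ) :
    (a + b) ^ (n + 2) - a ^ (n + 2) ∈ G (k + 1) := by
  have hab : a + b ∈ G 1 := Submodule.add_mem _ ha (hanti hk hb)
  have h1 : (a + b) ^ (n + 1) - a ^ (n + 1) ∈ G k := by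
    induction n with
    | zero => simpa using hb
    | succ n ih =>
      rw [show (a + b) ^ (n + 1 + 1) - a ^ (n + 1 + 1)
        = ((a + b) ^ (n + 1) - a ^ (n + 1)) * (a + b) + a ^ (n + 1) * b by
          simp only [pow_succ _ (n + 1)]; noncomm_ring]
      exact Submodule.add_mem _ (hanti k.le_succ (hmul _ _ _ ih _ hab))
        (hanti (by omega) (hmul _ _ _ (pow_succ_mem_of_mul_mem hmul ha n) _ hb))
  rw [show (a + b) ^ (n + 2) - a ^ (n + 2)
    = ((a + b) ^ (n + 1) - a ^ (n + 1)) * (a + b) + a ^ (n + 1) * b by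
      simp only [pow_succ _ (n + 1)]; noncomm_ring]
  exact Submodule.add_mem _ (hmul _ _ _ h1 _ hab)
    (hanti (by omega) (hmul _ _ _ (pow_succ_mem_of_mul_mem hmul ha n) _ hb))

/-- A logarithm by successive approximation: subtracting the error `δ` from `Z` cancels it in the
linear term, and the higher powers change only one step deeper in the filtration. -/
theorem exists_truncExp_eq_one_add (hmul : ∀ i j, ∀ a ∈ G i, ∀ b ∈ G j, a * b ∈ G (i + j))
    (hanti : Antitone G) (hm : G m = ⊥) (M : ℕ) {w : R} (hw : w ∈ G 1) :
    ∃ Z ∈ G 1, truncExp K (M + 2) Z = 1 + w := by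
  have h (k : ℕ) : ∃ Z ∈ G 1, truncExp K (M + 2) Z - (1 + w) ∈ G (k + 1) := by
    induction k with
    | zero =>
      refine ⟨0, Submodule.zero_mem _, ?_⟩
      rw [truncExp, sum_range_succ', sum_eq_zero (fun k _ => by simp)]
      simpa using hw
    | succ k ih =>
      obtain ⟨Z, hZ, h⟩ := ih
      set δ := truncExp K (M + 2) Z - (1 + w) with hδ
      have h' := Submodule.neg_mem _ h
      refine ⟨Z + -δ, Submodule.add_mem _ hZ (hanti (by omega) h'), ?_⟩
      have : truncExp K (M + 2) (Z + -δ) - (1 + w) = ∑ n ∈ range M,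
          ((n + 2).factorial : K)⁻¹ • ((Z + -δ) ^ (n + 2) - Z ^ (n + 2)) := by
        have h1 : truncExp K (M + 2) (Z + -δ) - (1 + w)
            = truncExp K (M + 2) (Z + -δ) - truncExp K (M + 2) Z + δ := by rw [hδ]; abel
        rw [h1, truncExp, truncExp, ← sum_sub_distrib, sum_range_succ', sum_range_succ']
        simp [smul_sub]
      rw [this]
      exact Submodule.sum_mem _ fun n _ => Submodule.smul_mem _ _
        (add_pow_sub_pow_mem hmul hanti (by omega) hZ h' n)
  obtain ⟨Z, hZ, h⟩ := h m
  refine ⟨Z, hZ, sub_eq_zero.1 ?_⟩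
  have := hanti m.le_succ h
  rwa [hm] at this

theorem truncExp_sub_one_mem (hmul : ∀ i j, ∀ a ∈ G i, ∀ b ∈ G j, a * b ∈ G (i + j))
    (hanti : Antitone G) (M : ℕ) {a : R} (ha : a ∈ G 1) : truncExp K (M + 1) a - 1 ∈ G 1 := by
  rw [truncExp, sum_range_succ', pow_zero, Nat.factorial_zero, Nat.cast_one, inv_one, one_smul,
    add_sub_cancel_right]
  exact Submodule.sum_mem _ fun k _ => Submodule.smul_mem _ _
    (hanti (by omega) (pow_succ_mem_of_mul_mem hmul ha k))

theorem map_nestedBracket_of_leibniz (D : R →ₗ[K] R) (hD : ∀ a b, D (a * b) = D a * b + a * D b) :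
    ∀ l : List R, (∀ a ∈ l, D a = a) → D (nestedBracket l) = (l.length : K) • nestedBracket l
  | [], _ => by simp [nestedBracket]
  | [a], h => by simpa [nestedBracket] using h a (by simp)
  | a :: b :: l, h => by
    have ih := map_nestedBracket_of_leibniz D hD (b :: l) fun c hc => h c (List.mem_cons_of_mem _ hc)
    rw [nestedBracket, Ring.lie_def, map_sub, hD, hD, ih, h a (by simp), List.length_cons,
      List.length_cons, List.length_cons]
    push_cast
    simp only [mul_smul_comm, smul_mul_assoc, add_smul, one_smul, mul_add, add_mul,
      smul_sub]
    abel

theorem map_bchTerm_of_leibniz (D : R →ₗ[K] R) (hD : ∀ a b, D (a * b) = D a * b + a * D b)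
    {X Y : R} (hX : D X = X) (hY : D Y = Y) (N : ℕ) :
    D (bchTerm K X Y N) = (N : K) • bchTerm K X Y N := by
  simp only [bchTerm, map_sum, smul_sum, map_smul]
  refine sum_congr rfl fun n _ => sum_congr rfl fun f hf => ?_
  rw [map_nestedBracket_of_leibniz D hD _ fun a ha => ?_, smul_comm,
    WeightGradedDGPreLie.dynkinWord_length, (mem_filter.1 hf).2.2]
  rcases eq_or_eq_of_mem_dynkinWord ha with rfl | rfl <;> assumption

open Polynomial in
/-- The derivation `t d/dt` of `R[t]`. -/
noncomputable def eulerDerivation (K R : Type*) [Field K] [Ring R] [Algebra K R] :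
    R[X] →ₗ[K] R[X] :=
  LinearMap.mulLeft K X ∘ₗ (derivative (R := R)).restrictScalars K

open Polynomial in
theorem eulerDerivation_mul (p q : R[X]) :
    eulerDerivation K R (p * q) = eulerDerivation K R p * q + p * eulerDerivation K R q := by
  change X * derivative (p * q) = X * derivative p * q + p * (X * derivative q)
  rw [derivative_mul, mul_add, mul_assoc, ← mul_assoc p, ← X_mul, mul_assoc]

open Polynomial in
theorem eulerDerivation_C_mul_X (a : R) : eulerDerivation K R (C a * X) = C a * X := by
  change X * derivative (C a * X) = _
  rw [derivative_C_mul, derivative_X, mul_one, X_mul]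

open Polynomial in
theorem coeff_eulerDerivation (p : R[X]) (n : ℕ) :
    (eulerDerivation K R p).coeff n = (n : K) • p.coeff n := by
  change (X * derivative p).coeff n = _
  rcases n with _ | n
  · simp
  · rw [coeff_X_mul, coeff_derivative, ← Nat.cast_succ, ← Nat.cast_commute, ← nsmul_eq_mul,
      Nat.cast_smul_eq_nsmul]

open Polynomial in
theorem eq_of_eulerDerivation_eq [CharZero K] {p q : R[X]} (hp : p.coeff 0 = 0)
    (hq : q.coeff 0 = 0) (h : eulerDerivation K R p = eulerDerivation K R q) : p = q := by
  ext n
  rcases n with _ | n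
  · rw [hp, hq]
  · have := congrArg (fun r => r.coeff (n + 1)) h
    simp only [coeff_eulerDerivation] at this
    exact smul_right_injective R (Nat.cast_ne_zero (R := K).2 n.succ_ne_zero) this

open Polynomial in
/-- The polynomials that are divisible by `t ^ k` and whose coefficients of `t ^ n` lie in `F n`. -/
def reesFiltration (F : ℕ → Submodule K R) (k : ℕ) : Submodule K R[X] where
  carrier := {p | (∀ n < k, p.coeff n = 0) ∧ ∀ n, p.coeff n ∈ F n}
  zero_mem' := by simp
  add_mem' := fun {p q} hp hq => ⟨fun n hn => by rw [coeff_add, hp.1 n hn, hq.1 n hn, add_zero],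
    fun n => by rw [coeff_add]; exact Submodule.add_mem _ (hp.2 n) (hq.2 n)⟩
  smul_mem' := fun c p hp => ⟨fun n hn => by rw [coeff_smul, hp.1 n hn, smul_zero],
    fun n => by rw [coeff_smul]; exact Submodule.smul_mem _ _ (hp.2 n)⟩

theorem reesFiltration_mul {F : ℕ → Submodule K R}
    (hmul : ∀ i j, ∀ a ∈ F i, ∀ b ∈ F j, a * b ∈ F (i + j)) (i j : ℕ) :
    ∀ p ∈ reesFiltration F i, ∀ q ∈ reesFiltration F j, p * q ∈ reesFiltration F (i + j) := by
  rintro p ⟨hp, hp'⟩ q ⟨hq, hq'⟩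
  constructor
  · intro n hn
    rw [Polynomial.coeff_mul]
    refine sum_eq_zero fun x hx => ?_
    rw [HasAntidiagonal.mem_antidiagonal] at hx
    by_cases h : x.1 < i
    · rw [hp _ h, zero_mul]
    · rw [hq _ (by omega), mul_zero]
  · intro n
    rw [Polynomial.coeff_mul]
    refine Submodule.sum_mem _ fun x hx => ?_
    rw [HasAntidiagonal.mem_antidiagonal] at hx
    exact hx ▸ hmul _ _ _ (hp' _) _ (hq' _)

theorem reesFiltration_antitone (F : ℕ → Submodule K R) : Antitone (reesFiltration F) :=
  fun _ _ h _ hp => ⟨fun n hn => hp.1 n (hn.trans_le h), hp.2⟩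

/-- Divisibility kills the coefficients below `t ^ m`, and the condition on coefficients kills the
rest; thus adjoining `t` keeps nilpotency. -/
theorem reesFiltration_eq_bot {F : ℕ → Submodule K R} (hanti : Antitone F) (hm : F m = ⊥) :
    reesFiltration F m = ⊥ := by
  refine (Submodule.eq_bot_iff _).2 fun p hp => ?_
  ext n
  rcases lt_or_ge n m with h | h
  · exact hp.1 n h
  · have := hanti h (hp.2 n)
    rwa [hm] at this

variable [CharZero K]

/-- The Baker-Campbell-Hausdorff formula in Dynkin's form, in a nilpotent filtered algebra. -/
theorem truncExp_bch {F : ℕ → Submodule K R}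
    (hmul : ∀ i j, ∀ a ∈ F i, ∀ b ∈ F j, a * b ∈ F (i + j)) (hanti : Antitone F) (hm : F m = ⊥)
    {x y : R} (hx : x ∈ F 1) (hy : y ∈ F 1) :
    truncExp K (m + 2) x * truncExp K (m + 2) y
      = truncExp K (m + 2) (∑ N ∈ range m, bchTerm K x y N) := by
  set G := reesFiltration F with hG
  have hGmul := reesFiltration_mul hmul
  have hGanti := reesFiltration_antitone F
  have hGm := reesFiltration_eq_bot hanti hm
  have hmem {a : R} (ha : a ∈ F 1) : Polynomial.C a * Polynomial.X ∈ G 1 := by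
    refine ⟨fun n hn => ?_, fun n => ?_⟩
    · obtain rfl : n = 0 := by omega
      simp
    · rw [Polynomial.coeff_C_mul_X]
      split_ifs with h
      · exact h ▸ ha
      · exact Submodule.zero_mem _
  -- The parameter `t` makes `X = xt` and `Y = yt` fixed by `t d/dt`.
  set X := Polynomial.C x * Polynomial.X with hX
  set Y := Polynomial.C y * Polynomial.X with hY
  have hXG : X ∈ G 1 := hmem hx
  have hYG : Y ∈ G 1 := hmem hy
  have hpow {a : Polynomial R} (ha : a ∈ G 1) : a ^ (m + 2) = 0 := by
    have := hGanti (show m ≤ m + 1 + 1 by omega) (pow_succ_mem_of_mul_mem hGmul ha (m + 1))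
    rwa [hGm] at this
  obtain ⟨Z, hZG, hZ⟩ := exists_truncExp_eq_one_add (M := m) hGmul hGanti hGm
    (w := truncExp K (m + 2) X * truncExp K (m + 2) Y - 1) (by
      have h1 := truncExp_sub_one_mem hGmul hGanti (m + 1) hXG
      have h2 := truncExp_sub_one_mem hGmul hGanti (m + 1) hYG
      have h3 := hGanti (show 1 ≤ 1 + 1 by omega) (hGmul _ _ _ h1 _ h2)
      convert Submodule.add_mem _ (Submodule.add_mem _ h3 h1) h2 using 1
      noncomm_ring)
  rw [add_sub_cancel] at hZ
  have had {a : Polynomial R} (ha : a ∈ G 1) : IsNilpotent (ad K (Polynomial R) a) :=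
    ad_nilpotent_of_nilpotent ⟨_, hpow ha⟩
  obtain ⟨i, hi⟩ := had hXG
  obtain ⟨j, hj⟩ := had hYG
  obtain ⟨k, hk⟩ := had hZG
  -- One cutoff beyond all the nilpotency orders of `X`, `Y`, `Z` and their adjoints.
  obtain ⟨M, hM⟩ : ∃ M, M = m + i + j + k := ⟨_, rfl⟩
  have hle {a : Polynomial R} (ha : a ∈ G 1) :
      truncExp K (M + 2) a = truncExp K (m + 2) a := truncExp_of_le K (hpow ha) (by omega)
  have hDX := eulerDerivation_C_mul_X (K := K) x
  have hDY := eulerDerivation_C_mul_X (K := K) y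
  have hlong (l : List (Polynomial R)) (hl : ∀ a ∈ l, a = X ∨ a = Y) (h : m ≤ l.length) :
      nestedBracket l = 0 := by
    have := hGanti h (nestedBracket_mem_of_mul_mem hGmul l fun a ha => by
      rcases hl a ha with rfl | rfl <;> assumption)
    rwa [hGm] at this
  have key := derivation_eq_of_truncExp_eq_mul (eulerDerivation K R) eulerDerivation_mul hDX hDY
    (pow_eq_zero_of_le (by omega) (hpow hXG)) (pow_eq_zero_of_le (by omega) (hpow hYG))
    (pow_eq_zero_of_le (by omega) (hpow hZG)) (pow_eq_zero_of_le (by omega) hi)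
    (pow_eq_zero_of_le (by omega) hj) (pow_eq_zero_of_le (m := k) (n := M + 2) (by omega) hk)
    (by rw [hle hXG, hle hYG, hle hZG, hZ])
  rw [truncLog_apply_eq_sum_smul_bchTerm K (by omega) hlong] at key
  -- Both sides have the same image under `t d/dt` and no constant term.
  have hbch : Z = ∑ N ∈ range m, bchTerm K X Y N := by
    refine eq_of_eulerDerivation_eq (K := K) (hZG.1 0 one_pos) ?_ ?_
    · refine (Submodule.sum_mem (G 1) fun N _ => ?_).1 0 one_pos
      refine Submodule.sum_mem _ fun n _ => Submodule.sum_mem _ fun f hf => Submodule.smul_mem _ _ ?_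
      rcases eq_or_ne (dynkinWord X Y f) [] with h | h
      · rw [h]
        exact Submodule.zero_mem _
      · refine hGanti (List.length_pos_iff.2 h) (nestedBracket_mem_of_mul_mem hGmul _ fun a ha => ?_)
        rcases eq_or_eq_of_mem_dynkinWord ha with rfl | rfl <;> assumption
    · rw [key, map_sum]
      exact sum_congr rfl fun N _ => (map_bchTerm_of_leibniz _ eulerDerivation_mul hDX hDY N).symm
  -- Setting `t = 1` returns to `x` and `y`.
  let ev : Polynomial R →ₐ[K] R := Polynomial.eval₂AlgHom (AlgHom.id K R) 1 fun _ => Commute.one_right _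
  have hev (a : R) : ev (Polynomial.C a * Polynomial.X) = a := by
    simp [ev]
  have hfin := congrArg ev hZ
  rw [hbch, map_mul, map_truncExp, map_truncExp, map_truncExp, hev, hev, map_sum] at hfin
  rw [← hfin]
  congr 1
  refine sum_congr rfl fun N _ => ?_
  have := LieHom.map_bchTerm (K := K) (ev : Polynomial R →ₗ⁅K⁆ R) X Y N
  rw [AlgHom.coe_toLieHom] at this
  rw [this, hev, hev]

end NilpotentBCH

/-! ### Leibniz rule and symmetry of the braces. -/

section Brace

open Finset Function

theorem sum_update_update {ι L V : Type*} [Fintype ι] [DecidableEq ι] [AddCommMonoid V]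
    (Φ : (ι → L) → V) (h : L → L) (B : ι → L) (j : ι) (w : L) :
    ∑ k, Φ (update (update B j w) k (h (update B j w k)))
      = Φ (update B j (h w)) + ∑ k ∈ univ.erase j, Φ (update (update B k (h (B k))) j w) := by
  rw [← add_sum_erase _ _ (mem_univ j), update_self, update_idem]
  congr 1
  refine sum_congr rfl fun k hk => ?_
  have hk := ne_of_mem_erase hk
  rw [update_of_ne hk, update_comm hk]

theorem brace_snoc {L : Type*} [NonUnitalNonAssocRing L] (a : L) {n : ℕ} (B : Fin n → L) (z : L) :
    brace a (n + 1) (Fin.snoc B z : Fin (n + 1) → L)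
      = brace a n B * z - ∑ i, brace a n (update B i (B i * z)) := by
  simp [brace]

theorem brace_update_add {L : Type*} [NonUnitalNonAssocRing L] (a : L) {n : ℕ} (B : Fin n → L)
    (i : Fin n) (u v : L) : brace a n (update B i (u + v))
      = brace a n (update B i u) + brace a n (update B i v) := by
  induction n generalizing u v with
  | zero => exact i.elim0
  | succ n ih =>
    induction B using Fin.snocCases with | _ B z =>
    refine Fin.lastCases ?_ (fun j => ?_) i
    · simp only [Fin.update_snoc_last, brace_snoc, mul_add, ih, sum_add_distrib]
      abel
    · simp only [← Fin.snoc_update, brace_snoc,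
        sum_update_update (brace a n) (fun x => x * z), add_mul, ih, sum_add_distrib]
      abel

/-- The Leibniz rule for symmetric braces. -/
theorem map_brace_of_leibniz {L : Type*} [NonUnitalNonAssocRing L] (D : L →+ L)
    (hD : ∀ x y, D (x * y) = D x * y + x * D y) (a : L) {n : ℕ} (B : Fin n → L) :
    D (brace a n B) = brace (D a) n B + ∑ i, brace a n (update B i (D (B i))) := by
  induction n with
  | zero => simp [brace]
  | succ n ih =>
    induction B using Fin.snocCases with | _ B z =>
    rw [Fin.sum_univ_castSucc]
    simp only [Fin.update_snoc_last, Fin.snoc_castSucc, Fin.snoc_last, ← Fin.snoc_update,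
      brace_snoc, map_sub, map_sum, hD, ih, sum_update_update (brace a n) (fun x => x * z),
      sum_update_update (brace a n) D, brace_update_add, sum_add_distrib, sum_sub_distrib, add_mul,
      sum_mul]
    have : ∑ i, ∑ k ∈ univ.erase i, brace a n (update (update B k (D (B k))) i (B i * z))
        = ∑ i, ∑ k ∈ univ.erase i, brace a n (update (update B k (B k * z)) i (D (B i))) := by
      rw [sum_comm' (t' := univ) (s' := fun k => univ.erase k) (by simp [eq_comm])]
      refine sum_congr rfl fun i _ => sum_congr rfl fun k hk => ?_
      rw [update_comm (ne_of_mem_erase hk)]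
    rw [this]
    abel

variable {L : Type*} [RightPreLieRing L]

/-- Unfold the recursion twice. The associator of the inner brace with `y, z`, and the terms where
both act on one slot, are symmetric by the pre-Lie identity; the terms acting on two different slots
are symmetric by exchanging the slots. -/
theorem brace_snoc_snoc_comm (a : L) {n : ℕ} (B : Fin n → L) (y z : L) :
    brace a (n + 2) (Fin.snoc (Fin.snoc B y : Fin (n + 1) → L) z : Fin (n + 2) → L)
      = brace a (n + 2) (Fin.snoc (Fin.snoc B z : Fin (n + 1) → L) y : Fin (n + 2) → L) := by
  have hsymm (x : L) : x * y * z + x * (z * y) = x * z * y + x * (y * z) := by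
    have := RightPreLieRing.assoc_symm x y z
    simp only [associator] at this
    rw [sub_eq_sub_iff_add_eq_add] at this
    exact this
  have h1 : ∑ i, brace a n (update B i (B i * z * y)) + ∑ i, brace a n (update B i (B i * (y * z)))
      = ∑ i, brace a n (update B i (B i * y * z)) + ∑ i, brace a n (update B i (B i * (z * y))) := by
    simp only [← sum_add_distrib, ← brace_update_add, hsymm]
  have h2 : ∑ i, ∑ k ∈ univ.erase i, brace a n (update (update B k (B k * y)) i (B i * z))
      = ∑ i, ∑ k ∈ univ.erase i, brace a n (update (update B k (B k * z)) i (B i * y)) := by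
    rw [sum_comm' (t' := univ) (s' := fun k => univ.erase k) (by simp [eq_comm])]
    refine sum_congr rfl fun i _ => sum_congr rfl fun k hk => ?_
    rw [update_comm (ne_of_mem_erase hk)]
  have h3 := hsymm (brace a n B)
  have key (y z : L) :
      brace a (n + 2) (Fin.snoc (Fin.snoc B y : Fin (n + 1) → L) z : Fin (n + 2) → L)
      = (brace a n B * y * z - brace a n B * (y * z))
        - (∑ i, brace a n (update B i (B i * y)) * z + ∑ i, brace a n (update B i (B i * z)) * y)
        + (∑ i, brace a n (update B i (B i * z * y)) + ∑ i, brace a n (update B i (B i * (y * z))))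
        + ∑ i, ∑ k ∈ univ.erase i, brace a n (update (update B k (B k * y)) i (B i * z)) := by
    rw [brace_snoc, Fin.sum_univ_castSucc]
    simp only [Fin.update_snoc_last, Fin.snoc_castSucc, Fin.snoc_last, ← Fin.snoc_update,
      brace_snoc, sum_update_update (brace a n) (fun x => x * y), sum_add_distrib, sum_sub_distrib,
      sub_mul, sum_mul]
    abel
  rw [key y z, key z y, h1, h2, add_comm (∑ i, brace a n (update B i (B i * y)) * z),
    sub_eq_sub_iff_add_eq_add.2 h3]

theorem brace_snoc_comp_perm (a : L) {n : ℕ} (σ : Equiv.Perm (Fin n))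
    (hσ : ∀ B : Fin n → L, brace a n (B ∘ σ) = brace a n B) (B : Fin n → L) (z : L) :
    brace a (n + 1) (Fin.snoc (B ∘ σ) z : Fin (n + 1) → L)
      = brace a (n + 1) (Fin.snoc B z : Fin (n + 1) → L) := by
  rw [brace_snoc, brace_snoc, hσ,
    ← Equiv.sum_comp σ fun i => brace a n (update B i (B i * z))]
  congr 1
  refine sum_congr rfl fun i _ => ?_
  rw [← hσ (update B (σ i) _), update_comp_eq_of_injective _ σ.injective]
  rfl

/-- The symmetric braces are symmetric. -/
theorem brace_comp_perm (a : L) {n : ℕ} (B : Fin n → L) (σ : Equiv.Perm (Fin n)) :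
    brace a n (B ∘ σ) = brace a n B := by
  induction n with
  | zero => rfl
  | succ n ih =>
    -- Adjacent transpositions suffice: the one of the last two slots is `brace_snoc_snoc_comm`, the
    -- others come from the induction hypothesis.
    have hσ : σ ∈ Submonoid.closure
        (Set.range fun i : Fin n => Equiv.swap i.castSucc i.succ) := by
      rw [Equiv.Perm.mclosure_swap_castSucc_succ]
      trivial
    induction hσ using Submonoid.closure_induction generalizing B with
    | one => rfl
    | mul σ τ _ _ hσ hτ => exact (hτ (B ∘ σ)).trans (hσ B)
    | mem σ h =>
      obtain ⟨i, rfl⟩ := h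
      rcases n with _ | n
      · exact i.elim0
      induction B using Fin.snocCases with | _ B z =>
      refine Fin.lastCases ?_ (fun j => ?_) i
      · induction B using Fin.snocCases with | _ B y =>
        rw [← brace_snoc_snoc_comm]
        congr 1
        ext k
        refine Fin.lastCases ?_ (fun k => Fin.lastCases ?_ (fun k => ?_) k) k
        · simp
        · simp
        · have h1 : k.castSucc.castSucc ≠ (Fin.last n).castSucc := by
            simp [Fin.ext_iff]; omega
          have h2 : k.castSucc.castSucc ≠ (Fin.last n).succ := by
            simp [Fin.ext_iff]; omega
          simp only [comp_apply, Equiv.swap_apply_of_ne_of_ne h1 h2, Fin.snoc_castSucc]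
      · rw [← brace_snoc_comp_perm a (Equiv.swap j.castSucc j.succ) (fun B => ih B _)]
        congr 1
        ext k
        refine Fin.lastCases ?_ (fun k => ?_) k
        · rw [comp_apply, Equiv.swap_apply_of_ne_of_ne, Fin.snoc_last, Fin.snoc_last]
          · simp [Fin.ext_iff]; omega
          · simp [Fin.ext_iff]; omega
        · beta_reduce
          rw [Fin.succ_castSucc, comp_apply, (Fin.castSucc_injective _).swap_apply,
            Fin.snoc_castSucc, Fin.snoc_castSucc]
          rfl

/-- By symmetry the exceptional slot may be moved to the end, so sums over its position become
multiples of one brace. -/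
theorem brace_update_const (a c v : L) {n : ℕ} (i : Fin (n + 1)) :
    brace a (n + 1) (update (fun _ => c) i v)
      = brace a (n + 1) (Fin.snoc (fun _ : Fin n => c) v : Fin (n + 1) → L) := by
  rw [← brace_comp_perm a _ (Equiv.swap i (Fin.last n))]
  congr 1
  ext k
  refine Fin.lastCases ?_ (fun k => ?_) k
  · simp
  · rw [Fin.snoc_castSucc, comp_apply, update_of_ne]
    rw [Ne, Equiv.swap_apply_eq_iff, Equiv.swap_apply_left]
    exact k.castSucc_lt_last.ne

end Brace

section MapBrace

open Finset Function

theorem brace_mem_of_mul_mem {L : Type*} [NonUnitalNonAssocRing L] {F : ℕ → AddSubgroup L}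
    (hmul : ∀ i j, ∀ x ∈ F i, ∀ y ∈ F j, x * y ∈ F (i + j)) {a : L} (ha : a ∈ F 0) {n : ℕ}
    (b : Fin n → L) (w : Fin n → ℕ) (h : ∀ i, b i ∈ F (w i)) : brace a n b ∈ F (∑ i, w i) := by
  induction n with
  | zero => simpa [brace] using ha
  | succ n ih =>
    induction b using Fin.snocCases with | _ b z =>
    induction w using Fin.snocCases with | _ w v =>
    have hb (i : Fin n) : b i ∈ F (w i) := by simpa using h i.castSucc
    have hz : z ∈ F v := by simpa using h (Fin.last n)
    rw [brace_snoc, Fin.sum_univ_castSucc]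
    simp only [Fin.snoc_castSucc, Fin.snoc_last]
    refine sub_mem (hmul _ _ _ (ih b w hb) _ hz) (sum_mem fun i _ => ?_)
    have := ih (update b i (b i * z)) (update w i (w i + v)) fun j => by
      rcases eq_or_ne j i with rfl | hj
      · simpa using hmul _ _ _ (hb j) _ hz
      · simpa [hj] using hb j
    rwa [sum_update_of_mem (mem_univ i), sdiff_singleton_eq_erase, add_right_comm,
      add_sum_erase _ _ (mem_univ i)] at this

theorem map_brace {L L' F : Type*} [NonUnitalNonAssocRing L] [NonUnitalNonAssocRing L']
    [FunLike F L L'] [NonUnitalRingHomClass F L L'] (φ : F) (a : L) {n : ℕ} (b : Fin n → L) :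
    φ (brace a n b) = brace (φ a) n (φ ∘ b) := by
  induction n with
  | zero => rfl
  | succ n ih =>
    simp only [brace, map_sub, map_mul, map_sum, ih, comp_update]
    rfl

end MapBrace

/-! ### Formal series and the differential equation of `a ⊚ e^{lt}`. -/

/-- Formal power series in a central variable `t`, with coefficients in `L`. -/
def FormalSeries (L : Type*) := ℕ → L

namespace FormalSeries

open Finset Function

instance (L : Type*) [AddCommGroup L] : AddCommGroup (FormalSeries L) :=
  inferInstanceAs (AddCommGroup (ℕ → L))

/-- The coefficients of a formal series. -/
def coeff {L : Type*} (x : FormalSeries L) : ℕ → L := x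

section Ring

variable {L : Type*} [NonUnitalNonAssocRing L]

instance : NonUnitalNonAssocRing (FormalSeries L) where
  mul x y := fun n => ∑ p ∈ antidiagonal n, x p.1 * y p.2
  left_distrib x y z := by
    funext n
    change ∑ p ∈ antidiagonal n, x p.1 * (y p.2 + z p.2)
      = ∑ p ∈ antidiagonal n, x p.1 * y p.2 + ∑ p ∈ antidiagonal n, x p.1 * z p.2
    simp only [mul_add, sum_add_distrib]
  right_distrib x y z := by
    funext n
    change ∑ p ∈ antidiagonal n, (x p.1 + y p.1) * z p.2
      = ∑ p ∈ antidiagonal n, x p.1 * z p.2 + ∑ p ∈ antidiagonal n, y p.1 * z p.2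
    simp only [add_mul, sum_add_distrib]
  zero_mul x := by
    funext n
    exact sum_eq_zero fun p _ => zero_mul _
  mul_zero x := by
    funext n
    exact sum_eq_zero fun p _ => mul_zero _

theorem mul_apply (x y : FormalSeries L) (n : ℕ) :
    (x * y) n = ∑ p ∈ antidiagonal n, x p.1 * y p.2 := rfl

theorem add_apply (x y : FormalSeries L) (n : ℕ) : (x + y) n = x n + y n := rfl

theorem sub_apply (x y : FormalSeries L) (n : ℕ) : (x - y) n = x n - y n := rfl

theorem nsmul_apply (k : ℕ) (x : FormalSeries L) (n : ℕ) : (k • x) n = k • x n := rfl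

/-- The derivation `t d/dt`. -/
def euler : FormalSeries L →+ FormalSeries L where
  toFun x := fun n => n • x n
  map_zero' := by
    funext n
    exact smul_zero n
  map_add' x y := by
    funext n
    exact smul_add n (x n) (y n)

theorem euler_apply (x : FormalSeries L) (n : ℕ) : euler x n = n • x n := rfl

theorem euler_mul (x y : FormalSeries L) : euler (x * y) = euler x * y + x * euler y := by
  funext n
  simp only [euler_apply, add_apply, mul_apply, smul_sum, ← sum_add_distrib]
  refine sum_congr rfl fun p hp => ?_
  rw [← HasAntidiagonal.mem_antidiagonal.1 hp, add_smul, smul_mul_assoc, mul_smul_comm]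

/-- The constant series `a`. -/
def const (a : L) : FormalSeries L := fun n => if n = 0 then a else 0

/-- The series `l t`. -/
def linear (l : L) : FormalSeries L := fun n => if n = 1 then l else 0

theorem euler_const (a : L) : euler (const a) = 0 := by
  funext n
  rcases n with _ | n
  · exact zero_smul _ _
  · exact smul_zero _

theorem mul_linear_apply_zero (x : FormalSeries L) (l : L) : (x * linear l) 0 = 0 := by
  simp [mul_apply, linear]

theorem mul_linear_apply_succ (x : FormalSeries L) (l : L) (n : ℕ) :
    (x * linear l) (n + 1) = x n * l := by
  rw [mul_apply, sum_eq_single (n, 1)]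
  · rfl
  · rintro ⟨i, j⟩ h hne
    rw [HasAntidiagonal.mem_antidiagonal] at h
    have : j ≠ 1 := by
      rintro rfl
      exact hne (by simp at h ⊢; omega)
    simp [linear, this]
  · simp

/-- The series that are divisible by `t ^ k`. -/
def order (L : Type*) [NonUnitalNonAssocRing L] (k : ℕ) : AddSubgroup (FormalSeries L) where
  carrier := {x | ∀ n < k, x n = 0}
  zero_mem' := fun _ _ => rfl
  add_mem' := fun hx hy n hn => by rw [add_apply, hx n hn, hy n hn, add_zero]
  neg_mem' := fun {x} hx n hn => by
    change -x n = 0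
    rw [hx n hn, neg_zero]

theorem mul_mem_order (i j : ℕ) :
    ∀ x ∈ order L i, ∀ y ∈ order L j, x * y ∈ order L (i + j) := by
  intro x hx y hy n hn
  refine sum_eq_zero fun p hp => ?_
  rw [HasAntidiagonal.mem_antidiagonal] at hp
  by_cases h : p.1 < i
  · rw [hx _ h, zero_mul]
  · rw [hy _ (by omega), mul_zero]

end Ring

instance (L : Type*) [RightPreLieRing L] : RightPreLieRing (FormalSeries L) where
  assoc_symm' x y z := by
    -- The associator is a sum over triples of indices, so right symmetry is inherited from the
    -- coefficients.
    have key (x y z : FormalSeries L) : associator x y z = fun n =>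
        ∑ p ∈ antidiagonal n, ∑ q ∈ antidiagonal p.2, associator (x p.1) (y q.1) (z q.2) := by
      funext n
      rw [associator, sub_apply]
      simp only [mul_apply, associator, sum_sub_distrib, mul_sum, sum_mul, sum_sigma']
      congr 1
      refine sum_nbij' (fun s => ⟨(s.2.1, s.2.2 + s.1.2), (s.2.2, s.1.2)⟩)
        (fun s => ⟨(s.1.1 + s.2.1, s.2.2), (s.1.1, s.2.1)⟩) ?_ ?_ ?_ ?_ ?_
      · rintro ⟨⟨i, j⟩, k, l⟩ h
        simp at h ⊢
        omega
      · rintro ⟨⟨i, j⟩, k, l⟩ h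
        simp at h ⊢
        omega
      · rintro ⟨⟨i, j⟩, k, l⟩ h
        simp at h ⊢
        omega
      · rintro ⟨⟨i, j⟩, k, l⟩ h
        simp at h ⊢
        omega
      · rintro ⟨⟨i, j⟩, k, l⟩ _
        rfl
    rw [key, key]
    funext n
    refine sum_congr rfl fun p _ => ?_
    rw [← Nat.sum_antidiagonal_swap]
    exact sum_congr rfl fun q _ => RightPreLieRing.assoc_symm _ _ _

section Exp

variable (K : Type*) [Field K] {L : Type*} [RightPreLieRing L] [RightPreLieAlgebra K L]

/-- The series `e^{l t} - 1 = ∑ n ≥ 1, t ^ n l^{⋆n} / n!`. -/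
noncomputable def expSubOne (l : L) : FormalSeries L
  | 0 => 0
  | n + 1 => ((n + 1).factorial : K)⁻¹ • rightPow l n

theorem expSubOne_mem_order (l : L) : expSubOne K l ∈ order L 1 := fun n hn => by
  obtain rfl : n = 0 := by omega
  rfl

variable [CharZero K]

theorem _root_.inv_factorial_succ_mul (n : ℕ) :
    ((n + 1).factorial : K)⁻¹ * ((n + 1 : ℕ) : K) = (n.factorial : K)⁻¹ := by
  have h0 : ((n + 1 : ℕ) : K) ≠ 0 := Nat.cast_ne_zero.2 (by omega)
  rw [Nat.factorial_succ, Nat.cast_mul, mul_inv, mul_right_comm, inv_mul_cancel₀ h0, one_mul]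

/-- This is `t d/dt e^{lt} = e^{lt} ⋆ lt`, with the term `1 ⋆ lt = lt` separated so that no unit is
needed in `L`. -/
theorem euler_expSubOne (l : L) :
    euler (expSubOne K l) = linear l + expSubOne K l * linear l := by
  funext n
  rw [euler_apply, add_apply]
  rcases n with _ | _ | n
  · simp [mul_linear_apply_zero, linear]
  · rw [mul_linear_apply_succ]
    simp [expSubOne, linear, rightPow]
  · rw [mul_linear_apply_succ]
    have : linear l (n + 1 + 1) = 0 := rfl
    rw [this, zero_add, expSubOne, expSubOne, smul_mul_assoc, ← Nat.cast_smul_eq_nsmul K, smul_smul,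
      mul_comm, inv_factorial_succ_mul, rightPow]

/-- The differential equation `t d/dt (a ⊚ e^{l t}) = (a ⊚ e^{l t}) ⋆ l t`. -/
theorem sum_euler_brace_expSubOne (a l : L) {M N : ℕ} (hN : N ≤ M) :
    ∑ n ∈ range (M + 1), (n.factorial : K)⁻¹ •
        euler (brace (const a) n fun _ => expSubOne K l) N
      = ∑ n ∈ range (M + 1), (n.factorial : K)⁻¹ •
        (brace (const a) n (fun _ => expSubOne K l) * linear l) N := by
  set c := expSubOne K l with hc
  -- `q` and `r` are the contributions of the two summands of `t c' = lt + c ⋆ lt` to the derivative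
  -- of a brace.
  let q (n : ℕ) : FormalSeries L := brace (const a) (n + 1) (Fin.snoc (fun _ : Fin n => c) (linear l))
  let r (n : ℕ) : FormalSeries L :=
    brace (const a) (n + 1) (Fin.snoc (fun _ : Fin n => c) (c * linear l))
  have hzero (x : FormalSeries L) : brace x 0 (fun _ => c) = x := rfl
  have hzeroB (n : ℕ) (b : Fin n → FormalSeries L) : brace 0 n b = 0 := by
    induction n with
    | zero => rfl
    | succ n ih => simp [brace, ih]
  have hp (n : ℕ) : euler (brace (const a) (n + 1) fun _ => c) = (n + 1) • (q n + r n) := by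
    rw [map_brace_of_leibniz (L := FormalSeries L) euler euler_mul, euler_const, hzeroB, zero_add, hc,
      euler_expSubOne, ← hc]
    simp only [brace_update_const]
    have h := brace_update_add (const a)
      (Fin.snoc (fun _ : Fin n => c) c : Fin (n + 1) → FormalSeries L) (Fin.last n) (linear l)
      (c * linear l)
    simp only [Fin.update_snoc_last] at h
    rw [sum_const, card_univ, Fintype.card_fin, h]
  have hq (n : ℕ) : brace (const a) (n + 1) (fun _ => c) * linear l = q (n + 1) + (n + 1) • r n := by
    have h : q (n + 1) = brace (const a) (n + 1) (fun _ => c) * linear l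
      - ∑ i, brace (const a) (n + 1) (update (fun _ => c) i (c * linear l)) := brace_snoc _ _ _
    simp only [brace_update_const] at h
    rw [sum_const, card_univ, Fintype.card_fin] at h
    rw [h, sub_add_cancel]
  have hq0 : const a * linear l = q 0 := by
    have h : q 0 = const a * linear l - _ := brace_snoc _ _ _
    rw [h]
    simp
  -- After division by factorials the two sides differ only by the boundary term `q M / M!`, which
  -- is divisible by `t ^ (M + 1)`.
  have hqM : q M N = 0 := by
    refine brace_mem_of_mul_mem mul_mem_order (F := order L) (a := const a) (fun n hn => by omega)
      _ (fun _ => 1) (fun i => ?_) N (by simp; omega)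
    refine Fin.lastCases ?_ (fun i => ?_) i
    · rw [Fin.snoc_last]
      intro n hn
      obtain rfl : n = 0 := by omega
      rfl
    · rw [Fin.snoc_castSucc]
      exact expSubOne_mem_order K l
  rw [sum_range_succ', sum_range_succ', hzero, euler_const, hq0]
  simp only [hp, hq, nsmul_apply, add_apply, ← Nat.cast_smul_eq_nsmul K, smul_add, smul_smul,
    inv_factorial_succ_mul,
    sum_add_distrib]
  have h := sum_range_succ (fun n => (n.factorial : K)⁻¹ • q n N) M
  rw [hqM, smul_zero, add_zero, sum_range_succ'] at h
  rw [← h]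
  change _ + _ • (0 : L) = _
  rw [smul_zero]
  abel

/-- `a ⊚ e^{l t} = ∑ N, t ^ N (⋯((a ⋆ l) ⋆ l)⋯ ⋆ l) / N!`. -/
theorem sum_brace_expSubOne (a l : L) {M N : ℕ} (hN : N ≤ M) :
    ∑ n ∈ range (M + 1), (n.factorial : K)⁻¹ • (brace (const a) n fun _ => expSubOne K l).coeff N
      = (N.factorial : K)⁻¹ • (fun x => x * l)^[N] a := by
  unfold coeff
  induction N with
  | zero =>
    rw [sum_range_succ', sum_eq_zero, zero_add]
    · simp [brace, const]
    · intro n _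
      have : brace (const a) (n + 1) (fun _ => expSubOne K l) 0 = 0 :=
        brace_mem_of_mul_mem mul_mem_order (F := order L) (a := const a) (fun n hn => by omega)
          _ (fun _ => 1) (fun i => expSubOne_mem_order K l) 0 (by simp)
      rw [this, smul_zero]
  | succ N ih =>
    -- The differential equation is the recursion `(N + 1) f_{N+1} = f_N ⋆ l` for the coefficients.
    have h := sum_euler_brace_expSubOne K a l hN
    simp only [euler_apply, mul_linear_apply_succ, ← smul_mul_assoc] at h
    rw [← sum_mul, ih (by omega)] at h
    have h0 : ((N + 1 : ℕ) : K) ≠ 0 := Nat.cast_ne_zero.2 (by omega)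
    simp only [← Nat.cast_smul_eq_nsmul K, smul_comm _ ((N + 1 : ℕ) : K)] at h
    rw [← smul_sum, smul_mul_assoc] at h
    rw [Nat.factorial_succ, Nat.cast_mul, mul_inv, mul_smul, iterate_succ_apply', ← h, smul_smul,
      inv_mul_cancel₀ h0, one_smul]

end Exp

end FormalSeries

/-! ### Convergent series and their evaluation at `t = 1`. -/

namespace WeightGradedDGPreLie

open Finset Function

variable {K : Type*} [Field K] {C : ℤ → ℕ → Type*}
  [∀ p n, AddCommGroup (C p n)] [∀ p n, Module K (C p n)] {S : WeightGradedDGPreLie K C}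

theorem eq_of_forall_sub_mem {x y : S.Deg0} (h : ∀ k, x - y ∈ S.filtration k) : x = y := by
  refine sub_eq_zero.1 ?_
  funext k
  exact h (k + 1) k k.lt_succ_self

theorem series_sub_sum_mem {f : ℕ → S.Deg0} (hf : ∀ n, f n ∈ S.filtration n) (k : ℕ) :
    S.series f - ∑ n ∈ range k, f n ∈ S.filtration k := by
  intro i hi
  change S.series f i - (∑ n ∈ range k, f n) i = 0
  rw [series_apply hf, sum_apply, sum_apply, sub_eq_zero]
  refine sum_subset (range_subset_range.2 hi) fun n _ hn => hf n i ?_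
  simpa using hn

/-- The weight filtration is separated, so identities between infinite sums reduce to congruences of
partial sums. -/
theorem eq_of_forall_sub_sum_mem {f : ℕ → S.Deg0} (hf : ∀ n, f n ∈ S.filtration n) {x : S.Deg0}
    (h : ∀ k, x - ∑ n ∈ range k, f n ∈ S.filtration k) : x = S.series f :=
  eq_of_forall_sub_mem fun k => by
    have := Submodule.sub_mem _ (h k) (series_sub_sum_mem hf k)
    rwa [sub_sub_sub_cancel_right] at this

theorem mem_filtration_zero (x : S.Deg0) : x ∈ S.filtration 0 := fun _ hi => by omega

section Evaluation

variable (S)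

/-- The series `∑ n, t ^ n x_n` such that `x_n` lies in the `n`-th step of the filtration. -/
def convergentSeries : NonUnitalSubring (FormalSeries S.Deg0) where
  carrier := {x | ∀ n, x.coeff n ∈ S.filtration n}
  zero_mem' := fun _ => Submodule.zero_mem _
  add_mem' := fun hx hy n => Submodule.add_mem _ (hx n) (hy n)
  neg_mem' := fun hx n => Submodule.neg_mem _ (hx n)
  mul_mem' := fun {x y} hx hy n => by
    change ∑ p ∈ antidiagonal n, x.coeff p.1 * y.coeff p.2 ∈ S.filtration n
    refine Submodule.sum_mem _ fun p hp => ?_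
    exact HasAntidiagonal.mem_antidiagonal.1 hp ▸ mul_mem_filtration (hx p.1) (hy p.2)

variable {S} in
theorem mem_convergentSeries {x : FormalSeries S.Deg0} :
    x ∈ S.convergentSeries ↔ ∀ n, x.coeff n ∈ S.filtration n := Iff.rfl

variable {S} in
theorem coeff_mem_filtration (x : S.convergentSeries) (n : ℕ) : x.1.coeff n ∈ S.filtration n :=
  mem_convergentSeries.1 x.2 n

/-- The evaluation of convergent series at `t = 1`. -/
noncomputable def evalOne : S.convergentSeries →ₙ+* S.Deg0 where
  toFun x := S.series x.1.coeff
  map_zero' := by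
    funext k
    exact finsum_zero
  map_add' x y := by
    refine (eq_of_forall_sub_sum_mem (coeff_mem_filtration (x + y)) fun k => ?_).symm
    have := Submodule.add_mem _ (series_sub_sum_mem (coeff_mem_filtration x) k) (series_sub_sum_mem (coeff_mem_filtration y) k)
    rw [sub_add_sub_comm, ← sum_add_distrib] at this
    exact this
  map_mul' x y := by
    refine (eq_of_forall_sub_sum_mem (coeff_mem_filtration (x * y)) fun k => ?_).symm
    set X := S.series x.1.coeff
    set Y := S.series y.1.coeff
    set X' := ∑ n ∈ range k, x.1.coeff n with hX'
    set Y' := ∑ n ∈ range k, y.1.coeff n with hY'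
    have h1 : X * Y - X' * Y' ∈ S.filtration k := by
      rw [show X * Y - X' * Y' = (X - X') * Y + X' * (Y - Y') by
        rw [sub_mul, mul_sub]; abel]
      refine Submodule.add_mem _ ?_ ?_
      · exact mul_mem_filtration (series_sub_sum_mem (coeff_mem_filtration x) k) (mem_filtration_zero Y)
      · have := mul_mem_filtration (mem_filtration_zero X') (series_sub_sum_mem (coeff_mem_filtration y) k)
        rwa [zero_add] at this
    have h2 : X' * Y' - ∑ n ∈ range k, (x * y).1.coeff n ∈ S.filtration k := by
      intro i hi
      change (X' * Y') i - (∑ n ∈ range k, (x * y).1.coeff n) i = 0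
      rw [hX', hY', sum_mul_sum, sub_eq_zero, sum_apply, sum_apply]
      simp only [sum_apply]
      rw [← sum_range_antidiagonal_eq_sum_sum k fun a b => (x.1.coeff a * y.1.coeff b) i]
      · symm
        have hc (n : ℕ) : ∑ p ∈ antidiagonal n, (x.1.coeff p.1 * y.1.coeff p.2) i
            = (x * y).1.coeff n i := (sum_apply _ _ _).symm
        rw [sum_congr rfl fun n _ => hc n]
        exact sum_subset (range_subset_range.2 (by omega)) fun n _ hn =>
          coeff_mem_filtration (x * y) n i (by simp at hn; omega)
      · intro a b hab
        exact mul_mem_filtration (coeff_mem_filtration x a) (coeff_mem_filtration y b) i (by omega)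
    have := Submodule.add_mem _ h1 h2
    rwa [sub_add_sub_cancel] at this

theorem evalOne_apply (x : S.convergentSeries) : S.evalOne x = S.series x.1.coeff := rfl

/-- The exponential `a ↦ ∑ n, (⋯((a ⋆ x) ⋆ x)⋯ ⋆ x) / n!` of the right multiplication by `x`. -/
noncomputable def rightExp (x : S.g0) (a : S.Deg0) : S.Deg0 :=
  S.series fun n => (n.factorial : K)⁻¹ • (fun b => b * (x : S.Deg0))^[n] a

variable {S}

theorem iterate_mul_right_mem (x : S.g0) (a : S.Deg0) (n : ℕ) :
    (fun b => b * (x : S.Deg0))^[n] a ∈ S.filtration n := by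
  induction n with
  | zero => exact mem_filtration_zero a
  | succ n ih =>
    rw [iterate_succ_apply']
    exact mul_mem_filtration ih (mem_filtration_one.2 x.2)

theorem rightExp_term_mem (x : S.g0) (a : S.Deg0) (n : ℕ) :
    (n.factorial : K)⁻¹ • (fun b => b * (x : S.Deg0))^[n] a ∈ S.filtration n :=
  Submodule.smul_mem _ _ (iterate_mul_right_mem x a n)

theorem exp_term_mem (x : S.g0) (n : ℕ) :
    ((n + 1).factorial : K)⁻¹ • rightPow (x : S.Deg0) n ∈ S.filtration n :=
  Submodule.smul_mem _ _ (filtration_mono n.le_succ (rightPow_mem x.2 n))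

theorem one_mul_deg0 (x : S.Deg0) : 1 * x = x := S.unit_mul x

theorem exp_sub_one (x : S.g0) : (S.exp x).1 - 1
    = S.series fun n => ((n + 1).factorial : K)⁻¹ • rightPow (x : S.Deg0) n :=
  add_sub_cancel_left _ _

theorem iterate_mul_right_one (x : S.Deg0) (n : ℕ) :
    (fun b => b * x)^[n + 1] 1 = rightPow x n := by
  induction n with
  | zero => exact one_mul_deg0 x
  | succ n ih => rw [iterate_succ_apply', ih]; rfl

theorem exp_eq_rightExp_one (x : S.g0) : (S.exp x).1 = S.rightExp x 1 := by
  refine eq_of_forall_sub_sum_mem (rightExp_term_mem x 1) fun k => ?_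
  rcases k with _ | k
  · exact mem_filtration_zero _
  · have h := series_sub_sum_mem (exp_term_mem x) (k + 1)
    rw [← exp_sub_one, sum_range_succ] at h
    rw [sum_range_succ', ← sub_sub, sub_right_comm]
    simp only [iterate_mul_right_one]
    -- The two indexings of the exponential series are shifted by one; the extra term is negligible
    -- at this weight.
    have h' : ((k + 1).factorial : K)⁻¹ • rightPow (x : S.Deg0) k ∈ S.filtration (k + 1) :=
      Submodule.smul_mem _ _ (rightPow_mem x.2 k)
    have := Submodule.add_mem _ h h'
    rw [← sub_sub, sub_add_cancel] at this
    simpa using this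

theorem expSubOne_mem_convergentSeries (x : S.g0) :
    FormalSeries.expSubOne K (x : S.Deg0) ∈ S.convergentSeries := mem_convergentSeries.2 fun n => by
  rcases n with _ | n
  · exact mem_filtration_zero _
  · exact Submodule.smul_mem _ _ (rightPow_mem x.2 n)

theorem const_mem_convergentSeries (a : S.Deg0) :
    FormalSeries.const a ∈ S.convergentSeries := mem_convergentSeries.2 fun n => by
  rcases n with _ | n
  · exact mem_filtration_zero _
  · exact Submodule.zero_mem _

theorem evalOne_const (a : S.Deg0) :
    S.evalOne ⟨FormalSeries.const a, const_mem_convergentSeries a⟩ = a := by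
  refine (eq_of_forall_sub_sum_mem (coeff_mem_filtration ⟨_, const_mem_convergentSeries a⟩) fun k => ?_).symm
  rcases k with _ | k
  · exact mem_filtration_zero _
  · rw [sum_range_succ', sum_eq_zero (fun n _ => by rfl), zero_add]
    change a - a ∈ _
    rw [sub_self]
    exact Submodule.zero_mem _

theorem evalOne_expSubOne (x : S.g0) :
    S.evalOne ⟨FormalSeries.expSubOne K (x : S.Deg0), expSubOne_mem_convergentSeries x⟩
      = (S.exp x).1 - 1 := by
  refine (eq_of_forall_sub_sum_mem
    (coeff_mem_filtration ⟨_, expSubOne_mem_convergentSeries x⟩) fun k => ?_).symm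
  rcases k with _ | k
  · exact mem_filtration_zero _
  · rw [sum_range_succ', exp_sub_one]
    have h := series_sub_sum_mem (exp_term_mem x) (k + 1)
    have h' : ((k + 1).factorial : K)⁻¹ • rightPow (x : S.Deg0) k ∈ S.filtration (k + 1) :=
      Submodule.smul_mem _ _ (rightPow_mem x.2 k)
    have := Submodule.add_mem _ h h'
    rw [sum_range_succ, ← sub_sub, sub_add_cancel] at this
    change _ - (_ + (0 : S.Deg0)) ∈ _
    rw [add_zero]
    exact this

variable [CharZero K]

/-- The circle product by `e^x` is the exponential of the right multiplication by `x`. -/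
theorem circ_exp (a : S.Deg0) (x : S.g0) : S.circ a (S.exp x) = S.rightExp x a := by
  set c : S.convergentSeries :=
    ⟨FormalSeries.expSubOne K (x : S.Deg0), expSubOne_mem_convergentSeries x⟩ with hc
  set A : S.convergentSeries := ⟨FormalSeries.const a, const_mem_convergentSeries a⟩ with hA
  -- Evaluation at `t = 1` is multiplicative, hence commutes with braces.
  have hbrace (n : ℕ) : brace a n (fun _ => (S.exp x).1 - 1)
      = S.series (brace (FormalSeries.const a) n
        fun _ => FormalSeries.expSubOne K (x : S.Deg0)).coeff := by
    have h1 := map_brace S.evalOne A (fun _ : Fin n => c)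
    have h2 := map_brace (NonUnitalSubringClass.subtype S.convergentSeries) A (fun _ : Fin n => c)
    rw [evalOne_apply] at h1
    have h3 : S.evalOne ∘ (fun _ : Fin n => c) = fun _ => (S.exp x).1 - 1 :=
      funext fun _ => evalOne_expSubOne x
    rw [h3, evalOne_const] at h1
    rw [← h1]
    exact congrArg (fun x => S.series x.coeff) h2
  have hconv (n : ℕ) : (brace (FormalSeries.const a) n
      fun _ => FormalSeries.expSubOne K (x : S.Deg0)) ∈ S.convergentSeries := by
    have h2 := map_brace (NonUnitalSubringClass.subtype S.convergentSeries) A (fun _ : Fin n => c)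
    exact h2 ▸ (brace A n fun _ => c).2
  refine eq_of_forall_sub_sum_mem (rightExp_term_mem x a) fun k => ?_
  have hterm (n : ℕ) : (n.factorial : K)⁻¹ • brace a n (fun _ => (S.exp x).1 - 1)
      ∈ S.filtration n :=
    Submodule.smul_mem _ _ (brace_const_mem a (S.sub_one_apply_zero (S.exp x)) n)
  rcases k with _ | k
  · exact mem_filtration_zero _
  have h1 := series_sub_sum_mem hterm (k + 1)
  -- Modulo weight `k + 1` each brace may be replaced by its coefficients up to `t ^ k`; exchanging
  -- the sums brings in `sum_brace_expSubOne`.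
  have h2 : ∑ n ∈ range (k + 1), (n.factorial : K)⁻¹ • brace a n (fun _ => (S.exp x).1 - 1)
      - ∑ N ∈ range (k + 1), (N.factorial : K)⁻¹ • (fun b => b * (x : S.Deg0))^[N] a
        ∈ S.filtration (k + 1) := by
    have h3 : ∑ N ∈ range (k + 1), (N.factorial : K)⁻¹ • (fun b => b * (x : S.Deg0))^[N] a
        = ∑ n ∈ range (k + 1), (n.factorial : K)⁻¹ • ∑ N ∈ range (k + 1),
          (brace (FormalSeries.const a) n fun _ => FormalSeries.expSubOne K (x : S.Deg0)).coeff N := by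
      simp only [smul_sum]
      rw [sum_comm]
      refine sum_congr rfl fun N hN => ?_
      rw [← FormalSeries.sum_brace_expSubOne K a (x : S.Deg0)
        (Nat.lt_succ_iff.1 (mem_range.1 hN))]
    rw [h3, ← sum_sub_distrib]
    refine Submodule.sum_mem _ fun n _ => ?_
    rw [← smul_sub, hbrace]
    exact Submodule.smul_mem _ _ (series_sub_sum_mem (mem_convergentSeries.1 (hconv n)) (k + 1))
  have := Submodule.add_mem _ h1 h2
  rwa [sub_add_sub_cancel] at this

end Evaluation

/-! ### Bijectivity of the pre-Lie exponential. -/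

section Bijective

theorem rightPow_sub_rightPow_mem {x y : S.Deg0} (hx : x ∈ S.filtration 1) (hy : y ∈ S.filtration 1)
    {k : ℕ} (h : x - y ∈ S.filtration k) (n : ℕ) :
    rightPow x (n + 1) - rightPow y (n + 1) ∈ S.filtration (k + 1) := by
  have hstep (n : ℕ) : rightPow x (n + 1) - rightPow y (n + 1)
      = (rightPow x n - rightPow y n) * x + rightPow y n * (x - y) := by
    rw [rightPow, rightPow, sub_mul, mul_sub]
    abel
  have hy' (n : ℕ) : rightPow y n * (x - y) ∈ S.filtration (k + 1) :=
    filtration_mono (by omega) (mul_mem_filtration (rightPow_mem (mem_filtration_one.1 hy) n) h)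
  have h' : rightPow x n - rightPow y n ∈ S.filtration k := by
    induction n with
    | zero => exact h
    | succ n ih =>
      rw [hstep]
      exact Submodule.add_mem _ (filtration_mono k.le_succ (mul_mem_filtration ih hx))
        (filtration_mono k.le_succ (hy' n))
  rw [hstep]
  exact Submodule.add_mem _ (mul_mem_filtration h' hx) (hy' n)

/-- The exponential is the identity to leading order: the powers beyond the first differ one weight
deeper than `x` and `y` do. -/
theorem exp_sub_exp_sub_mem {x y : S.g0} {k : ℕ}
    (h : (x : S.Deg0) - y ∈ S.filtration k) :
    (S.exp x).1 - (S.exp y).1 - ((x : S.Deg0) - y) ∈ S.filtration (k + 1) := by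
  have hx := series_sub_sum_mem (exp_term_mem x) (k + 1)
  have hy := series_sub_sum_mem (exp_term_mem y) (k + 1)
  have hd : ∑ n ∈ range k, (((n + 1 + 1).factorial : K)⁻¹ • rightPow (x : S.Deg0) (n + 1)
      - ((n + 1 + 1).factorial : K)⁻¹ • rightPow (y : S.Deg0) (n + 1)) ∈ S.filtration (k + 1) := by
    refine Submodule.sum_mem _ fun n _ => ?_
    rw [← smul_sub]
    exact Submodule.smul_mem _ _ (rightPow_sub_rightPow_mem (mem_filtration_one.2 x.2)
      (mem_filtration_one.2 y.2) h n)
  have h0 (z : S.g0) : ((0 + 1).factorial : K)⁻¹ • rightPow (z : S.Deg0) 0 = z := by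
    simp [rightPow]
  rw [sum_range_succ', h0, ← exp_sub_one] at hx hy
  rw [sum_sub_distrib] at hd
  convert Submodule.add_mem _ (Submodule.sub_mem _ hx hy) hd using 1
  abel

theorem exp_injective : Injective S.exp := by
  intro x y h
  refine Subtype.ext (eq_of_forall_sub_mem fun k => ?_)
  induction k with
  | zero => exact mem_filtration_zero _
  | succ k ih =>
    have := exp_sub_exp_sub_mem ih
    rw [h, sub_self, zero_sub] at this
    exact (Submodule.neg_mem_iff _).1 this

theorem groupLike_sub_apply_zero (u v : S.GroupLike) : (u.1 - v.1) 0 = 0 := by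
  change u.1 0 - v.1 0 = 0
  rw [u.2, v.2, sub_self]

/-- Iterate `x ↦ x + (u - e^x)` from `0`; each step improves the error by one weight. -/
theorem exp_surjective : Surjective S.exp := by
  intro u
  let z : ℕ → S.g0 := fun j =>
    (fun x => x + ⟨u.1 - (S.exp x).1, groupLike_sub_apply_zero u (S.exp x)⟩)^[j] 0
  have hz (j : ℕ) : ((z (j + 1) : S.g0) : S.Deg0) - z j = u.1 - (S.exp (z j)).1 := by
    simp only [z, iterate_succ_apply']
    exact add_sub_cancel_left _ _
  have hu (j : ℕ) : u.1 - (S.exp (z j)).1 ∈ S.filtration (j + 1) := by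
    induction j with
    | zero => exact mem_filtration_one.2 (groupLike_sub_apply_zero u _)
    | succ j ih =>
      have := exp_sub_exp_sub_mem (x := z (j + 1)) (y := z j) (by rwa [hz])
      rw [hz] at this
      convert Submodule.neg_mem _ this using 1
      abel
  have hstab (i j : ℕ) (hij : i ≤ j) : ((z j : S.g0) : S.Deg0) i = ((z i : S.g0) : S.Deg0) i := by
    induction j, hij using Nat.le_induction with
    | base => rfl
    | succ j hij ih =>
      rw [← ih]
      have := hz j ▸ hu j
      exact sub_eq_zero.1 (this i (by omega))
  -- The component of weight `i` no longer changes after step `i`, so the diagonal is the limit.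
  let x : S.g0 := ⟨fun i => ((z i : S.g0) : S.Deg0) i, (z 0).2⟩
  have hx (j : ℕ) : ((x : S.g0) : S.Deg0) - z j ∈ S.filtration (j + 1) := fun i hi =>
    sub_eq_zero.2 (hstab i j (by omega)).symm
  refine ⟨x, Subtype.ext (eq_of_forall_sub_mem fun k => ?_)⟩
  have h1 := filtration_mono (k + 1).le_succ (exp_sub_exp_sub_mem (hx k))
  have h2 := Submodule.sub_mem _ (Submodule.add_mem _ h1 (hx k)) (hu k)
  rw [sub_add_cancel] at h2
  refine filtration_mono k.le_succ ?_
  convert h2 using 1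
  abel

end Bijective

end WeightGradedDGPreLie

/-! ### Exponentials of right multiplications and the two groups. -/

namespace WeightGradedDGPreLie

open Finset Function

attribute [local instance] LieRing.ofAssociativeRing

variable {K : Type*} [Field K] {C : ℤ → ℕ → Type*}
  [∀ p n, AddCommGroup (C p n)] [∀ p n, Module K (C p n)] (S : WeightGradedDGPreLie K C)

/-- The right multiplication by `x`, modulo the elements of weight at least `m`. -/
def rightMulMod (m : ℕ) (x : S.g0) : Module.End K (S.Deg0 ⧸ S.filtration m) :=
  (S.filtration m).mapQ (S.filtration m) (LinearMap.mulRight K (x : S.Deg0)) fun _ ha =>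
    filtration_mono m.le_succ (mul_mem_filtration ha (mem_filtration_one.2 x.2))

theorem rightMulMod_mk (m : ℕ) (x : S.g0) (a : S.Deg0) :
    S.rightMulMod m x ((S.filtration m).mkQ a) = (S.filtration m).mkQ (a * x) := rfl

theorem rightMulMod_pow_mk (m : ℕ) (x : S.g0) (a : S.Deg0) (n : ℕ) :
    (S.rightMulMod m x ^ n) ((S.filtration m).mkQ a)
      = (S.filtration m).mkQ ((fun b => b * (x : S.Deg0))^[n] a) := by
  induction n with
  | zero => rfl
  | succ n ih => rw [pow_succ', Module.End.mul_apply, ih, rightMulMod_mk, iterate_succ_apply']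

theorem rightMulMod_pow_eq_zero (m : ℕ) (x : S.g0) : S.rightMulMod m x ^ m = 0 := by
  refine LinearMap.ext fun v => ?_
  obtain ⟨a, rfl⟩ := (S.filtration m).mkQ_surjective v
  rw [rightMulMod_pow_mk]
  exact (Submodule.Quotient.mk_eq_zero _).2 (iterate_mul_right_mem x a m)

theorem rightMulMod_neg (m : ℕ) (x : S.g0) : S.rightMulMod m (-x) = -S.rightMulMod m x := by
  refine LinearMap.ext fun v => ?_
  obtain ⟨a, rfl⟩ := (S.filtration m).mkQ_surjective v
  rw [LinearMap.neg_apply, rightMulMod_mk, rightMulMod_mk, ← map_neg, ← mul_neg]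
  rfl

theorem mkQ_rightExp {m M : ℕ} (h : m ≤ M) (x : S.g0) (a : S.Deg0) :
    (S.filtration m).mkQ (S.rightExp x a)
      = truncExp K M (S.rightMulMod m x) ((S.filtration m).mkQ a) := by
  have h1 := filtration_mono h (series_sub_sum_mem (rightExp_term_mem x a) M)
  rw [← Submodule.Quotient.mk_eq_zero, Submodule.Quotient.mk_sub, sub_eq_zero] at h1
  refine h1.trans ?_
  rw [truncExp, LinearMap.sum_apply, ← Submodule.mkQ_apply, map_sum]
  refine sum_congr rfl fun n _ => ?_
  rw [map_smul, LinearMap.smul_apply, rightMulMod_pow_mk]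

theorem eq_of_forall_mkQ_eq {x y : S.Deg0}
    (h : ∀ m, (S.filtration m).mkQ x = (S.filtration m).mkQ y) : x = y :=
  eq_of_forall_sub_mem fun m => (Submodule.Quotient.eq _).1 (h m)

/-- The representation `x ↦ (a ↦ -a ⋆ x)` of `g_0`, modulo the elements of weight at least `m`. -/
def negRightMulMod (m : ℕ) : S.g0 →ₗ⁅K⁆ Module.End K (S.Deg0 ⧸ S.filtration m) where
  toFun x := -S.rightMulMod m x
  map_add' x y := by
    refine LinearMap.ext fun v => ?_
    obtain ⟨a, rfl⟩ := (S.filtration m).mkQ_surjective v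
    change -(S.filtration m).mkQ (a * (x + y)) = -(S.filtration m).mkQ (a * x)
      + -(S.filtration m).mkQ (a * y)
    rw [mul_add, map_add, neg_add]
  map_smul' c x := by
    refine LinearMap.ext fun v => ?_
    obtain ⟨a, rfl⟩ := (S.filtration m).mkQ_surjective v
    change -(S.filtration m).mkQ (a * (c • (x : S.Deg0))) = c • -(S.filtration m).mkQ (a * x)
    rw [mul_smul_comm, map_smul, smul_neg]
  map_lie' {x y} := by
    refine LinearMap.ext fun v => ?_
    obtain ⟨a, rfl⟩ := (S.filtration m).mkQ_surjective v
    simp only [Ring.lie_def, LinearMap.sub_apply, Module.End.mul_apply, LinearMap.neg_apply,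
      map_neg, neg_neg, rightMulMod_mk]
    -- The pre-Lie identity gives `a ⋆ [x, y] = (a ⋆ x) ⋆ y - (a ⋆ y) ⋆ x`. Operators compose in the
    -- opposite order, whence the minus sign in the representation.
    change -(S.filtration m).mkQ (a * (x * y - y * x)) = (S.filtration m).mkQ (a * y * x)
      - (S.filtration m).mkQ (a * x * y)
    rw [← map_sub, ← map_neg]
    congr 1
    have := RightPreLieRing.assoc_symm a (x : S.Deg0) y
    simp only [associator] at this
    rw [sub_eq_sub_iff_add_eq_add] at this
    rw [mul_sub, neg_sub, sub_eq_sub_iff_add_eq_add, add_comm]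
    exact this

/-- The endomorphisms that raise the weight by at least `k`. -/
def endFiltration (m k : ℕ) : Submodule K (Module.End K (S.Deg0 ⧸ S.filtration m)) where
  carrier := {T | ∀ i, ∀ v ∈ (S.filtration i).map (S.filtration m).mkQ,
    T v ∈ (S.filtration (i + k)).map (S.filtration m).mkQ}
  zero_mem' := fun _ _ _ => Submodule.zero_mem _
  add_mem' := fun hT hU i v hv => Submodule.add_mem _ (hT i v hv) (hU i v hv)
  smul_mem' := fun c _ hT i v hv => Submodule.smul_mem _ c (hT i v hv)

theorem endFiltration_mul (m i j : ℕ) : ∀ T ∈ S.endFiltration m i, ∀ U ∈ S.endFiltration m j,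
    T * U ∈ S.endFiltration m (i + j) := fun T hT U hU k v hv => by
  have := hT _ _ (hU k v hv)
  rwa [add_assoc, add_comm j i] at this

theorem endFiltration_antitone (m : ℕ) : Antitone (S.endFiltration m) :=
  fun _ _ h _ hT i v hv => Submodule.map_mono
    (fun _ hx => filtration_mono (Nat.add_le_add_left h i) hx) (hT i v hv)

theorem endFiltration_eq_bot (m : ℕ) : S.endFiltration m m = ⊥ := by
  refine (Submodule.eq_bot_iff _).2 fun T hT => LinearMap.ext fun v => ?_
  obtain ⟨a, rfl⟩ := (S.filtration m).mkQ_surjective v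
  obtain ⟨b, hb, h⟩ := hT 0 _ (Submodule.mem_map_of_mem (mem_filtration_zero a))
  rw [← h, LinearMap.zero_apply]
  rw [zero_add] at hb
  exact (Submodule.Quotient.mk_eq_zero _).2 hb

theorem negRightMulMod_mem (m : ℕ) (x : S.g0) : S.negRightMulMod m x ∈ S.endFiltration m 1 := by
  intro i v hv
  obtain ⟨a, ha, rfl⟩ := hv
  exact Submodule.neg_mem ((S.filtration (i + 1)).map (S.filtration m).mkQ)
    (Submodule.mem_map_of_mem (mul_mem_filtration ha (mem_filtration_one.2 x.2)))

theorem negRightMulMod_bch (m : ℕ) (x y : S.g0) :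
    S.negRightMulMod m (∑ N ∈ range m, bchTerm K x y N) = S.negRightMulMod m (S.bch x y) := by
  refine LinearMap.ext fun v => ?_
  obtain ⟨a, rfl⟩ := (S.filtration m).mkQ_surjective v
  change -(S.filtration m).mkQ (a * (∑ N ∈ range m, bchTerm K x y N : S.g0))
    = -(S.filtration m).mkQ (a * (S.bch x y : S.g0))
  congr 1
  symm
  refine (Submodule.Quotient.eq _).2 ?_
  rw [← mul_sub]
  have h : ((∑ N ∈ range m, bchTerm K x y N : S.g0) : S.Deg0)
      = ∑ N ∈ range m, ((bchTerm K x y N : S.g0) : S.Deg0) := map_sum S.g0.subtype _ _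
  rw [h]
  have := mul_mem_filtration (mem_filtration_zero a) (series_sub_sum_mem (bchTerm_mem x y) m)
  rwa [zero_add] at this

theorem exp_zero_val : (S.exp 0).1 = 1 := by
  rw [← sub_eq_zero, exp_sub_one]
  refine (eq_of_forall_sub_sum_mem (exp_term_mem 0) fun k => ?_).symm
  rw [sum_eq_zero, sub_zero]
  · exact Submodule.zero_mem _
  · rintro (_ | n) _
    · exact smul_zero _
    · exact (congrArg _ (mul_zero _)).trans (smul_zero _)

variable [CharZero K]

/-- The exponentials of right multiplications compose by the Baker-Campbell-Hausdorff product. -/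
theorem rightExp_bch (x y : S.g0) (a : S.Deg0) :
    S.rightExp (S.bch x y) a = S.rightExp y (S.rightExp x a) := by
  refine S.eq_of_forall_mkQ_eq fun m => ?_
  have hm : m ≤ m + 2 := by omega
  rw [S.mkQ_rightExp hm, S.mkQ_rightExp hm, S.mkQ_rightExp hm, ← Module.End.mul_apply]
  have h := truncExp_bch (K := K) (S.endFiltration_mul m) (S.endFiltration_antitone m)
    (S.endFiltration_eq_bot m) (S.negRightMulMod_mem m x) (S.negRightMulMod_mem m y)
  simp only [← LieHom.map_bchTerm] at h
  rw [← map_sum, negRightMulMod_bch] at h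
  change truncExp K (m + 2) (-S.rightMulMod m x) * truncExp K (m + 2) (-S.rightMulMod m y)
    = truncExp K (m + 2) (-S.rightMulMod m (S.bch x y)) at h
  have hinv (z : S.g0) :
      truncExp K (m + 2) (-S.rightMulMod m z) * truncExp K (m + 2) (S.rightMulMod m z) = 1 :=
    truncExp_neg_mul_truncExp K (pow_eq_zero_of_le hm (S.rightMulMod_pow_eq_zero m z))
  have hinv' : truncExp K (m + 2) (S.rightMulMod m (S.bch x y))
      * truncExp K (m + 2) (-S.rightMulMod m (S.bch x y)) = 1 := by
    have := hinv (-S.bch x y)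
    rwa [rightMulMod_neg, neg_neg] at this
  -- Inverting the BCH formula for `-R_x` and `-R_y` reverses the order of the factors.
  have hmul : truncExp K (m + 2) (-S.rightMulMod m (S.bch x y))
      * (truncExp K (m + 2) (S.rightMulMod m y) * truncExp K (m + 2) (S.rightMulMod m x)) = 1 := by
    rw [← h, mul_assoc, ← mul_assoc (truncExp K (m + 2) (-S.rightMulMod m y)), hinv, one_mul, hinv]
  rw [left_inv_eq_right_inv hinv' hmul]

theorem rightExp_neg_rightExp (x : S.g0) (a : S.Deg0) :
    S.rightExp x (S.rightExp (-x) a) = a := by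
  refine S.eq_of_forall_mkQ_eq fun m => ?_
  rw [S.mkQ_rightExp le_rfl, S.mkQ_rightExp le_rfl, ← Module.End.mul_apply, rightMulMod_neg]
  have := truncExp_neg_mul_truncExp K (S.rightMulMod_pow_eq_zero m (-x))
  rw [rightMulMod_neg, neg_neg] at this
  rw [this, Module.End.one_apply]

theorem circG_exp (x y : S.g0) : S.circG (S.exp x) (S.exp y) = S.exp (S.bch x y) := by
  refine Subtype.ext ?_
  change S.circ (S.exp x).1 (S.exp y) = _
  rw [circ_exp, exp_eq_rightExp_one, exp_eq_rightExp_one, rightExp_bch]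

/-- The group of group-like elements, for the circle product. -/
noncomputable abbrev groupLikeGroup : Group S.GroupLike :=
  letI : Mul S.GroupLike := ⟨S.circG⟩
  letI : One S.GroupLike := ⟨⟨1, Pi.single_eq_same 0 S.unit⟩⟩
  letI : Inv S.GroupLike := ⟨fun u => S.exp (-(exp_surjective u).choose)⟩
  Group.ofLeftAxioms
    -- Only `v` and `w` need be exponentials: `rightExp_bch` holds on all of `A_0`.
    (fun u v w => by
      obtain ⟨y, rfl⟩ := exp_surjective v
      obtain ⟨z, rfl⟩ := exp_surjective w
      change S.circG (S.circG u (S.exp y)) (S.exp z) = S.circG u (S.circG (S.exp y) (S.exp z))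
      rw [circG_exp]
      refine Subtype.ext ?_
      change S.circ (S.circ u.1 (S.exp y)) (S.exp z) = S.circ u.1 (S.exp (S.bch y z))
      rw [circ_exp, circ_exp, circ_exp, rightExp_bch])
    (fun u => by
      obtain ⟨x, rfl⟩ := exp_surjective u
      refine Subtype.ext ?_
      change S.circ 1 (S.exp x) = _
      rw [circ_exp, exp_eq_rightExp_one])
    (fun u => by
      have hx := (exp_surjective u).choose_spec
      refine Subtype.ext ((congrArg (S.circ _) hx.symm).trans ?_)
      rw [circ_exp]
      change S.rightExp _ (S.exp (-(exp_surjective u).choose)).1 = 1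
      rw [exp_eq_rightExp_one, rightExp_neg_rightExp])

end WeightGradedDGPreLie

theorem mainTheorem1 {K : Type*} [Field K] [CharZero K] {C : ℤ → ℕ → Type*}
    [∀ p n, AddCommGroup (C p n)] [∀ p n, Module K (C p n)] (S : WeightGradedDGPreLie K C) :
    ∃ (gauge : Group S.g0) (grouplike : Group S.GroupLike),
      (∀ x y : S.g0, gauge.mul x y = S.bch x y) ∧
      gauge.one = 0 ∧
      (∀ u v : S.GroupLike, grouplike.mul u v = S.circG u v) ∧
      (grouplike.one).1 = 1 ∧
      ∃ e : S.g0 ≃* S.GroupLike, ∀ x : S.g0, e x = S.exp x := by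
  let grouplike := S.groupLikeGroup
  let e : S.g0 ≃ S.GroupLike := Equiv.ofBijective S.exp ⟨S.exp_injective, S.exp_surjective⟩
  -- The group structure on `g_0` is transported along the exponential, and `circG_exp` identifies
  -- its product with BCH.
  refine ⟨e.group, grouplike, fun x y => ?_, ?_, fun _ _ => rfl, rfl, ?_⟩
  · refine (Equiv.symm_apply_eq e).2 ?_
    exact S.circG_exp x y
  · refine (Equiv.symm_apply_eq e).2 ?_
    exact Subtype.ext S.exp_zero_val.symm
  · let _ := e.group
    exact ⟨e.mulEquiv, fun _ => rfl⟩
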